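/- **Setting.** Let $(\mathcal M,g_{ab})$ be a smooth 4-dimensional Lorentzian manifold of signature $(-,+,+,+)$ with Levi-Civita connection $\nabla$ and curvature convention $\nabla_c\nabla_d u^a-\nabla_d\nabla_c u^a=R^a{}_{bcd}u^b$, carrying smooth fields $\Xi$, $s$ (scalars), $L_{ab}=L_{(ab)}$, a field $d^a{}_{bcd}$ with the algebraic symmetries of a Weyl tensor (including tracefreeness), and a symmetric tracefree field $T_{ab}$. Put $$T_{abc}=\Xi\nabla_{[a}T_{b]c}-g_{c[a}T_{b]d}\nabla^d\Xi-3T_{c[a}\nabla_{b]}\Xi .$$ Let $\lambda<0$. Let $\mathcal T\subset\mathcal M$ be a connected, smoothly embedded timelike hypersurface with smooth unit normal $n^a$ ($n_an^a=1$), and suppose that the tracefree metric conformal Einstein field equations hold at the points of $\mathcal T$ (in particular, if they hold on $\mathcal M$): $$\nabla_a\nabla_b\Xi=-\Xi L_{ab}+s g_{ab}+\tfrac12\Xi^3T_{ab},\qquad \nabla_a s=-L_{ac}\nabla^c\Xi+\tfrac12\Xi^2T_{ab}\nabla^b\Xi,$$ $$\nabla_aL_{bc}-\nabla_bL_{ac}=\Xi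 T_{abc}+\nabla_e\Xi\, d^e{}_{cab},\qquad \nabla_e d^e{}_{cab}=T_{abc},\qquad \lambda=6\Xi s-3\nabla_c\Xi\nabla^c\Xi,$$ $$R^a{}_{bcd}=\Xi d^a{}_{bcd}+2\delta_{[c}{}^aL_{d]b}+2L_{[c}{}^ag_{d]b},\qquad \nabla^aT_{ab}=0 .$$ On $\mathcal T$ let $\ell_{ij}$ be the induced Lorentzian metric, with Levi-Civita connection $D$, Ricci tensor $r_{ij}$, Ricci scalar $r$ and Schouten tensor $l_{ij}=r_{ij}-\tfrac14 r\,\ell_{ij}$. Let $K_{ij}$ be the extrinsic curvature, $K(X,Y)=g(\nabla_Xn,Y)$ for $X,Y$ tangent to $\mathcal T$. Let $\Sigma=n^a\nabla_a\Xi$, let $L_i$ and $L_{ij}$ be the pull-backs to $\mathcal T$ of $n^cL_{ac}$ and $L_{ab}$, and let $\Omega=\Xi|_{\mathcal T}$. **Lemma.** Suppose that there is a smooth function $\varkappa$ on $\mathcal T$ such that on $\mathcal T$ $$\Sigma=\sqrt{\tfrac{|\lambda|}{3}},\qquad s=\Sigma\varkappa,\qquad K_{ij}=\varkappa\,\ell_{ij},\qquad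 L_i=-D_i\varkappa,\qquad L_{ij}=l_{ij}-\tfrac12\varkappa^2\ell_{ij}.$$ If $\Omega=0$ on some non-empty (smoothly embedded, 2-dimensional) spacelike hypersurface $\mathcal C_\star$ of $\mathcal T$, then $\Omega=0$ on all of $\mathcal T$. -/

import Mathlib

open scoped Manifold ContDiff

noncomputable section

namespace TracefreeCFE

/-! ## Local coordinate calculus for a pseudo-Riemannian metric

A covariant `k`-tensor field in coordinates is a function `A` of the coordinates `y` and of a
multi-index `μ : Fin k → Fin n`; a metric is a matrix-valued function `G` of the coordinates. -/

section Coordinates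

variable {n : ℕ}

/-- The partial derivative `∂_α f` at `y`. -/
def pd (f : EuclideanSpace ℝ (Fin n) → ℝ) (α : Fin n) (y : EuclideanSpace ℝ (Fin n)) : ℝ :=
  fderiv ℝ f y (EuclideanSpace.single α 1)

/-- The Christoffel symbols
`Γ^α_{βγ} = ½ g^{αδ} (∂_β g_{δγ} + ∂_γ g_{δβ} - ∂_δ g_{βγ})` of the Levi-Civita connection. -/
def christoffel (G : EuclideanSpace ℝ (Fin n) → Matrix (Fin n) (Fin n) ℝ)
    (y : EuclideanSpace ℝ (Fin n)) (α β γ : Fin n) : ℝ :=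
  (1 / 2) * ∑ δ, (G y)⁻¹ α δ *
    (pd (fun z => G z δ γ) β y + pd (fun z => G z δ β) γ y - pd (fun z => G z β γ) δ y)

/-- The covariant derivative of a covariant `k`-tensor field. The derivative index comes first:
`(∇A)_{α μ₁ … μ_k} = ∂_α A_{μ₁ … μ_k} - ∑_i Γ^σ_{α μ_i} A_{μ₁ … σ … μ_k}`. -/
def covD (G : EuclideanSpace ℝ (Fin n) → Matrix (Fin n) (Fin n) ℝ) {k : ℕ}
    (A : EuclideanSpace ℝ (Fin n) → (Fin k → Fin n) → ℝ)
    (y : EuclideanSpace ℝ (Fin n)) (μ : Fin (k + 1) → Fin n) : ℝ :=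
  pd (fun z => A z (Fin.tail μ)) (μ 0) y
    - ∑ i : Fin k, ∑ σ, christoffel G y σ (μ 0) (Fin.tail μ i) *
        A y (Function.update (Fin.tail μ) i σ)

/-- The Riemann tensor `R^a_{bcd}`, with the convention
`∇_c ∇_d u^a - ∇_d ∇_c u^a = R^a_{bcd} u^b`. -/
def riemann (G : EuclideanSpace ℝ (Fin n) → Matrix (Fin n) (Fin n) ℝ)
    (y : EuclideanSpace ℝ (Fin n)) (a b c d : Fin n) : ℝ :=
  pd (fun z => christoffel G z a d b) c y - pd (fun z => christoffel G z a c b) d y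
    + ∑ f, (christoffel G y a c f * christoffel G y f d b
        - christoffel G y a d f * christoffel G y f c b)

/-- The Ricci tensor `R_{bd} = R^a_{bad}`. -/
def ricci (G : EuclideanSpace ℝ (Fin n) → Matrix (Fin n) (Fin n) ℝ)
    (y : EuclideanSpace ℝ (Fin n)) (b d : Fin n) : ℝ :=
  ∑ a, riemann G y a b a d

/-- The Ricci scalar `R = g^{bd} R_{bd}`. -/
def scalarCurv (G : EuclideanSpace ℝ (Fin n) → Matrix (Fin n) (Fin n) ℝ)
    (y : EuclideanSpace ℝ (Fin n)) : ℝ :=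
  ∑ b, ∑ d, (G y)⁻¹ b d * ricci G y b d

/-- The Schouten tensor `l_{ij} = r_{ij} - ¼ r h_{ij}` of a three-dimensional metric. -/
def schouten3 (G : EuclideanSpace ℝ (Fin 3) → Matrix (Fin 3) (Fin 3) ℝ)
    (y : EuclideanSpace ℝ (Fin 3)) (i j : Fin 3) : ℝ :=
  ricci G y i j - (1 / 4) * scalarCurv G y * G y i j

end Coordinates

/-! ## Tensor fields on manifolds -/

section Tensors

variable {n : ℕ} {M : Type*} [TopologicalSpace M] [ChartedSpace (EuclideanSpace ℝ (Fin n)) M]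

/-- A (not necessarily smooth) covariant `k`-tensor field on an `n`-manifold. -/
abbrev CovTensor (n : ℕ) (M : Type*) [TopologicalSpace M]
    [ChartedSpace (EuclideanSpace ℝ (Fin n)) M] (k : ℕ) : Type _ :=
  ∀ x : M, MultilinearMap ℝ (fun _ : Fin k => TangentSpace (𝓡 n) x) ℝ

/-- The coordinate vector `∂_μ` of the chart `e` at the point with coordinates `y`. -/
def coordVec (e : OpenPartialHomeomorph M (EuclideanSpace ℝ (Fin n)))
    (y : EuclideanSpace ℝ (Fin n)) (μ : Fin n) : TangentSpace (𝓡 n) (e.symm y) :=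
  mfderiv (𝓡 n) (𝓡 n) e.symm y (EuclideanSpace.single μ (1 : ℝ) : EuclideanSpace ℝ (Fin n))

/-- The components `A_{μ₁ … μ_k} = A(∂_{μ₁}, …, ∂_{μ_k})` in the chart `e`. -/
def comp {k : ℕ} (A : CovTensor n M k) (e : OpenPartialHomeomorph M (EuclideanSpace ℝ (Fin n)))
    (y : EuclideanSpace ℝ (Fin n)) (μ : Fin k → Fin n) : ℝ :=
  A (e.symm y) (fun i => coordVec e y (μ i))

/-- The component matrix of a covariant 2-tensor field in the chart `e`. -/
def compMatrix (A : CovTensor n M 2) (e : OpenPartialHomeomorph M (EuclideanSpace ℝ (Fin n)))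
    (y : EuclideanSpace ℝ (Fin n)) : Matrix (Fin n) (Fin n) ℝ :=
  Matrix.of fun a b => comp A e y ![a, b]

/-- A scalar field in the chart `e`, as a tensor field of rank `0`. -/
def scalarComp (f : M → ℝ) (e : OpenPartialHomeomorph M (EuclideanSpace ℝ (Fin n)))
    (y : EuclideanSpace ℝ (Fin n)) (_ : Fin 0 → Fin n) : ℝ :=
  f (e.symm y)

/-- Smoothness: the components are smooth in every chart of the atlas. -/
def SmoothTensor {k : ℕ} (A : CovTensor n M k) : Prop :=
  ∀ e ∈ atlas (EuclideanSpace ℝ (Fin n)) M, ∀ μ : Fin k → Fin n,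
    ContDiffOn ℝ ∞ (fun y => comp A e y μ) e.target

/-- The covariant 2-tensor `g` has signature `(-,+,…,+)` at `x`: it is diagonal in some basis of
the tangent space, with exactly one entry `-1` and all the others `1`. -/
def IsLorentzianAt (g : CovTensor n M 2) (x : M) : Prop :=
  ∃ (b : Module.Basis (Fin n) ℝ (TangentSpace (𝓡 n) x)) (i₀ : Fin n), ∀ i j,
    g x ![b i, b j] = if i = j then (if i = i₀ then -1 else 1) else 0

/-- The pull-back `f^* A`. -/
def pullback {m k : ℕ} {N : Type*} [TopologicalSpace N]
    [ChartedSpace (EuclideanSpace ℝ (Fin m)) N] (f : N → M) (A : CovTensor n M k) :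
    CovTensor m N k :=
  fun p => (A (f p)).compLinearMap fun _ => (mfderiv (𝓡 m) (𝓡 n) f p).toLinearMap

end Tensors

/-! ## The tracefree conformal Einstein field equations -/

/-- A smooth Lorentzian 4-manifold `(M, g)` with the smooth fields
`(Ξ, s, L_{ab}, d_{abcd}, T_{ab})` and their algebraic symmetries: `L` and `T` are symmetric, `T` is
tracefree, and `d` has all the algebraic symmetries of a Weyl tensor. -/
structure ConformalSpacetime (M : Type*) [TopologicalSpace M]
    [ChartedSpace (EuclideanSpace ℝ (Fin 4)) M] where
  /-- the metric `g_{ab}` -/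
  g : CovTensor 4 M 2
  /-- the conformal factor `Ξ` -/
  Xi : M → ℝ
  /-- the Friedrich scalar `s` -/
  s : M → ℝ
  /-- the Schouten tensor `L_{ab}` -/
  L : CovTensor 4 M 2
  /-- the rescaled Weyl tensor `d_{abcd}`, all indices lowered -/
  d : CovTensor 4 M 4
  /-- the unphysical energy-momentum tensor `T_{ab}` -/
  T : CovTensor 4 M 2
  smooth_g : SmoothTensor g
  smooth_Xi : ContMDiff (𝓡 4) 𝓘(ℝ, ℝ) ∞ Xi
  smooth_s : ContMDiff (𝓡 4) 𝓘(ℝ, ℝ) ∞ s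
  smooth_L : SmoothTensor L
  smooth_d : SmoothTensor d
  smooth_T : SmoothTensor T
  lorentzian : ∀ x, IsLorentzianAt g x
  symm_L : ∀ x (u v : TangentSpace (𝓡 4) x), L x ![u, v] = L x ![v, u]
  symm_T : ∀ x (u v : TangentSpace (𝓡 4) x), T x ![u, v] = T x ![v, u]
  tracefree_T : ∀ e ∈ atlas (EuclideanSpace ℝ (Fin 4)) M, ∀ y ∈ e.target,
    ∑ a, ∑ b, (compMatrix g e y)⁻¹ a b * comp T e y ![a, b] = 0
  antisymm_d : ∀ x (u v w z : TangentSpace (𝓡 4) x), d x ![u, v, w, z] = -d x ![v, u, w, z]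
  pairSymm_d : ∀ x (u v w z : TangentSpace (𝓡 4) x), d x ![u, v, w, z] = d x ![w, z, u, v]
  cyclic_d : ∀ x (u v w z : TangentSpace (𝓡 4) x),
    d x ![u, v, w, z] + d x ![u, w, z, v] + d x ![u, z, v, w] = 0
  tracefree_d : ∀ e ∈ atlas (EuclideanSpace ℝ (Fin 4)) M, ∀ y ∈ e.target, ∀ b c,
    ∑ a, ∑ f, (compMatrix g e y)⁻¹ a f * comp d e y ![a, b, f, c] = 0

section CFE

variable {M : Type*} [TopologicalSpace M] [ChartedSpace (EuclideanSpace ℝ (Fin 4)) M]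

/-- The gradient components `∇^a Ξ = g^{ab} ∂_b Ξ` in the chart `e`. -/
def gradXi (F : ConformalSpacetime M) (e : OpenPartialHomeomorph M (EuclideanSpace ℝ (Fin 4)))
    (y : EuclideanSpace ℝ (Fin 4)) (a : Fin 4) : ℝ :=
  ∑ b, (compMatrix F.g e y)⁻¹ a b * pd (fun z => F.Xi (e.symm z)) b y

/-- The rescaled Cotton tensor
`T_{abc} = Ξ ∇_{[a} T_{b]c} - g_{c[a} T_{b]d} ∇^d Ξ - 3 T_{c[a} ∇_{b]} Ξ` in the chart `e`. -/
def rescaledCotton (F : ConformalSpacetime M)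
    (e : OpenPartialHomeomorph M (EuclideanSpace ℝ (Fin 4)))
    (y : EuclideanSpace ℝ (Fin 4)) (a b c : Fin 4) : ℝ :=
  F.Xi (e.symm y) * ((1 / 2) * (covD (compMatrix F.g e) (comp F.T e) y ![a, b, c]
      - covD (compMatrix F.g e) (comp F.T e) y ![b, a, c]))
    - (∑ d, (1 / 2) * (comp F.g e y ![c, a] * comp F.T e y ![b, d]
        - comp F.g e y ![c, b] * comp F.T e y ![a, d]) * gradXi F e y d)
    - 3 * ((1 / 2) * (comp F.T e y ![c, a] * pd (fun z => F.Xi (e.symm z)) b y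
        - comp F.T e y ![c, b] * pd (fun z => F.Xi (e.symm z)) a y))

/-- The tracefree metric conformal Einstein field equations with Cosmological constant `lam`, in
the chart `e`, at the point with coordinates `y`. -/
structure CFEInChart (F : ConformalSpacetime M) (lam : ℝ)
    (e : OpenPartialHomeomorph M (EuclideanSpace ℝ (Fin 4)))
    (y : EuclideanSpace ℝ (Fin 4)) : Prop where
  /-- `∇_a ∇_b Ξ = -Ξ L_{ab} + s g_{ab} + ½ Ξ³ T_{ab}` -/
  hess_Xi : ∀ a b,
    covD (compMatrix F.g e) (covD (compMatrix F.g e) (scalarComp F.Xi e)) y ![a, b]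
      = -F.Xi (e.symm y) * comp F.L e y ![a, b] + F.s (e.symm y) * comp F.g e y ![a, b]
        + (1 / 2) * F.Xi (e.symm y) ^ 3 * comp F.T e y ![a, b]
  /-- `∇_a s = -L_{ac} ∇^c Ξ + ½ Ξ² T_{ab} ∇^b Ξ` -/
  grad_s : ∀ a, pd (fun z => F.s (e.symm z)) a y
      = -(∑ c, comp F.L e y ![a, c] * gradXi F e y c)
        + (1 / 2) * F.Xi (e.symm y) ^ 2 * ∑ b, comp F.T e y ![a, b] * gradXi F e y b
  /-- `∇_a L_{bc} - ∇_b L_{ac} = Ξ T_{abc} + ∇_f Ξ d^f_{cab}` -/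
  curl_L : ∀ a b c, covD (compMatrix F.g e) (comp F.L e) y ![a, b, c]
        - covD (compMatrix F.g e) (comp F.L e) y ![b, a, c]
      = F.Xi (e.symm y) * rescaledCotton F e y a b c
        + ∑ f, gradXi F e y f * comp F.d e y ![f, c, a, b]
  /-- `∇_f d^f_{cab} = T_{abc}` -/
  div_d : ∀ a b c, ∑ f, ∑ h, (compMatrix F.g e y)⁻¹ f h *
        covD (compMatrix F.g e) (comp F.d e) y ![f, h, c, a, b]
      = rescaledCotton F e y a b c
  /-- `λ = 6 Ξ s - 3 ∇_c Ξ ∇^c Ξ` -/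
  lambda_eq : lam = 6 * F.Xi (e.symm y) * F.s (e.symm y)
      - 3 * ∑ c, pd (fun z => F.Xi (e.symm z)) c y * gradXi F e y c
  /-- `R^a_{bcd} = Ξ d^a_{bcd} + 2 δ_{[c}^a L_{d]b} + 2 L_{[c}^a g_{d]b}` -/
  riemann_eq : ∀ a b c d, riemann (compMatrix F.g e) y a b c d
      = F.Xi (e.symm y) * (∑ f, (compMatrix F.g e y)⁻¹ a f * comp F.d e y ![f, b, c, d])
        + ((if a = c then 1 else 0) * comp F.L e y ![d, b]
          - (if a = d then 1 else 0) * comp F.L e y ![c, b])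
        + ∑ f, (compMatrix F.g e y)⁻¹ a f *
            (comp F.L e y ![c, f] * comp F.g e y ![d, b]
              - comp F.L e y ![d, f] * comp F.g e y ![c, b])
  /-- `∇^a T_{ab} = 0` -/
  div_T : ∀ b, ∑ a, ∑ c, (compMatrix F.g e y)⁻¹ a c *
      covD (compMatrix F.g e) (comp F.T e) y ![c, a, b] = 0

/-- The tracefree metric conformal Einstein field equations hold at the point `x`. -/
def SatisfiesCFEAt (F : ConformalSpacetime M) (lam : ℝ) (x : M) : Prop :=
  ∀ e ∈ atlas (EuclideanSpace ℝ (Fin 4)) M, x ∈ e.source → CFEInChart F lam e (e x)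

end CFE

/-! ## Hypersurfaces -/

section Hypersurfaces

variable {M : Type*} [TopologicalSpace M] [ChartedSpace (EuclideanSpace ℝ (Fin 4)) M]
  {N : Type*} [TopologicalSpace N] [ChartedSpace (EuclideanSpace ℝ (Fin 3)) N]
  {S : Type*} [TopologicalSpace S] [ChartedSpace (EuclideanSpace ℝ (Fin 2)) S]

/-- `ι : N → M` is a (smoothly embedded) timelike hypersurface of `(M, g)`, and `ν` is a smooth unit
normal vector field along it. -/
structure IsTimelikeHypersurface [IsManifold (𝓡 4) ∞ M] (F : ConformalSpacetime M) (ι : N → M)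
    (ν : ∀ p : N, TangentSpace (𝓡 4) (ι p)) : Prop where
  embedding : Manifold.IsSmoothEmbedding (𝓡 3) (𝓡 4) ∞ ι
  timelike : ∀ p, IsLorentzianAt (pullback (m := 3) ι F.g) p
  smooth_normal : ContMDiff (𝓡 3) (𝓡 4).tangent ∞
    (fun p => (⟨ι p, ν p⟩ : TangentBundle (𝓡 4) M))
  normal : ∀ p (X : TangentSpace (𝓡 3) p),
    F.g (ι p) ![ν p, mfderiv (𝓡 3) (𝓡 4) ι p X] = 0
  unit : ∀ p, F.g (ι p) ![ν p, ν p] = 1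

/-- `j : S → N` is a (smoothly embedded) spacelike hypersurface of the 3-manifold `N` with metric
`h`: the induced metric is positive definite. -/
structure IsSpacelikeSurface (h : CovTensor 3 N 2) (j : S → N) : Prop where
  embedding : Manifold.IsSmoothEmbedding (𝓡 2) (𝓡 3) ∞ j
  spacelike : ∀ q (X : TangentSpace (𝓡 2) q), X ≠ 0 → 0 < pullback (m := 2) j h q ![X, X]

/-- The components `∂_i ι^μ` of the differential of `ι` with respect to the chart `e'` of `N` and the
chart `e` of `M`, at the point of `N` with coordinates `z`. -/
def jacobian (ι : N → M) (e : OpenPartialHomeomorph M (EuclideanSpace ℝ (Fin 4)))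
    (e' : OpenPartialHomeomorph N (EuclideanSpace ℝ (Fin 3)))
    (z : EuclideanSpace ℝ (Fin 3)) (i : Fin 3) (μ : Fin 4) : ℝ :=
  pd (fun w => e (ι (e'.symm w)) μ) i z

/-- The components `ν^μ` in the chart `e` of `M` of a vector field along `ι`. -/
def normalComp (ι : N → M) (ν : ∀ p : N, TangentSpace (𝓡 4) (ι p))
    (e : OpenPartialHomeomorph M (EuclideanSpace ℝ (Fin 4)))
    (e' : OpenPartialHomeomorph N (EuclideanSpace ℝ (Fin 3)))
    (z : EuclideanSpace ℝ (Fin 3)) (μ : Fin 4) : ℝ :=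
  (show EuclideanSpace ℝ (Fin 4) from
    mfderiv (𝓡 4) (𝓡 4) e (ι (e'.symm z)) (ν (e'.symm z))) μ

/-- The extrinsic curvature `K_{ij} = K(∂_i, ∂_j)`, where `K(X, Y) = g(∇_X ν, Y)` for tangent vectors
`X`, `Y` of the hypersurface, with respect to the chart `e'` of `N`, computed with the chart `e`
of `M`. -/
def extrinsicCurv (g : CovTensor 4 M 2) (ι : N → M) (ν : ∀ p : N, TangentSpace (𝓡 4) (ι p))
    (e : OpenPartialHomeomorph M (EuclideanSpace ℝ (Fin 4)))
    (e' : OpenPartialHomeomorph N (EuclideanSpace ℝ (Fin 3)))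
    (z : EuclideanSpace ℝ (Fin 3)) (i j : Fin 3) : ℝ :=
  ∑ μ, ∑ ξ, comp g e (e (ι (e'.symm z))) ![μ, ξ] *
    (pd (fun w => normalComp ι ν e e' w μ) i z
      + ∑ ρ, ∑ σ, christoffel (compMatrix g e) (e (ι (e'.symm z))) μ ρ σ *
          jacobian ι e e' z i ρ * normalComp ι ν e e' z σ) *
    jacobian ι e e' z j ξ

/-- The normal derivative `Σ = ν^a ∇_a Ξ` along the hypersurface. -/
def normalDeriv (f : M → ℝ) (ι : N → M) (ν : ∀ p : N, TangentSpace (𝓡 4) (ι p)) (p : N) : ℝ :=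
  mfderiv (𝓡 4) 𝓘(ℝ, ℝ) f (ι p) (ν p)

/-- The boundary fields on the hypersurface `ι`, with unit normal `ν` and induced metric
`ℓ = ι^* g`, generated by the gauge function `κ`. -/
structure HasBoundaryFields (F : ConformalSpacetime M) (lam : ℝ) (ι : N → M)
    (ν : ∀ p : N, TangentSpace (𝓡 4) (ι p)) (κ : N → ℝ) : Prop where
  /-- `Σ = √(|λ|/3)` -/
  sigma : ∀ p, normalDeriv F.Xi ι ν p = √(|lam| / 3)
  /-- `s = Σ κ` -/
  friedrich : ∀ p, F.s (ι p) = normalDeriv F.Xi ι ν p * κ p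
  /-- `K_{ij} = κ ℓ_{ij}` -/
  extrinsic : ∀ e ∈ atlas (EuclideanSpace ℝ (Fin 4)) M,
    ∀ e' ∈ atlas (EuclideanSpace ℝ (Fin 3)) N, ∀ z ∈ e'.target, ι (e'.symm z) ∈ e.source →
      ∀ i j, extrinsicCurv F.g ι ν e e' z i j
        = κ (e'.symm z) * comp (pullback (m := 3) ι F.g) e' z ![i, j]
  /-- `L_i = -D_i κ`, where `L_i` is the pull-back of the normal-tangential part of `L_{ab}` -/
  schouten_normal : ∀ p (X : TangentSpace (𝓡 3) p),
    F.L (ι p) ![ν p, mfderiv (𝓡 3) (𝓡 4) ι p X] = -(mfderiv (𝓡 3) 𝓘(ℝ, ℝ) κ p X : ℝ)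
  /-- `L_{ij} = l_{ij} - ½ κ² ℓ_{ij}`, where `l_{ij}` is the Schouten tensor of `ℓ` -/
  schouten_tangential : ∀ e' ∈ atlas (EuclideanSpace ℝ (Fin 3)) N, ∀ z ∈ e'.target, ∀ i j,
    comp (pullback (m := 3) ι F.L) e' z ![i, j]
      = schouten3 (compMatrix (pullback (m := 3) ι F.g) e') z i j
        - (1 / 2) * κ (e'.symm z) ^ 2 * comp (pullback (m := 3) ι F.g) e' z ![i, j]

end Hypersurfaces

end TracefreeCFE

end

/-! Along the hypersurface, take as unknowns the scalar Ξ and the covector ω_a = ∇_aΞ − Σ n_a, where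
Σ denotes the constant √(|λ|/3). Since n is normal, D_iΩ is the pull-back of ω. Umbilicity together
with g(n,n) = 1 gives ∇_i n = ϰ ∂_i (`HasBoundaryFields.covAlong_normal`). In ∇_i ω_a the term s
g_{ia} of the Hessian equation, with s = Σϰ, therefore cancels Σ∇_i n_a, and only Ξ(−L_{ia} +
½Ξ²T_{ia}) is left. Thus (Ξ, ω) solves a linear homogeneous system of total differential equations
(`pd_boundaryUnknowns`). Grönwall's inequality on segments shows that its zero set is open and
closed (`exists_nhds_eq_zero_of_pd_linear`, `mem_of_locally_constant`), hence everything if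
non-empty.

The spacelike surface provides a zero of the whole system, not only of Ξ
(`mem_conformalZeros_of_spacelike`). Where Ξ = 0, the equation for λ reads g(∇Ξ,∇Ξ) = −λ/3 = Σ².
With n(Ξ) = Σ, the vector ∇Ξ − Σn is null and orthogonal to n. It is also orthogonal to the surface,
on which Ξ is constant. The surface directions and n span a positive definite hyperplane, and a null
vector orthogonal to such a hyperplane is zero; so ω = 0 there. -/

namespace TracefreeCFE

/-! ### Partial derivatives, Christoffel symbols and metric compatibility. -/

section CoordinateCalculus

variable {m n : ℕ}

lemma fderiv_eq_sum_pd (f : EuclideanSpace ℝ (Fin n) → ℝ) (y v : EuclideanSpace ℝ (Fin n)) :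
    fderiv ℝ f y v = ∑ ρ, pd f ρ y * v ρ := by
  conv_lhs => rw [← (EuclideanSpace.basisFun (Fin n) ℝ).sum_repr v]
  simp [map_sum, pd, mul_comm]

lemma pd_comp {h : EuclideanSpace ℝ (Fin n) → ℝ}
    {Φ : EuclideanSpace ℝ (Fin m) → EuclideanSpace ℝ (Fin n)} {z : EuclideanSpace ℝ (Fin m)}
    (hh : DifferentiableAt ℝ h (Φ z)) (hΦ : DifferentiableAt ℝ Φ z) (i : Fin m) :
    pd (fun w => h (Φ w)) i z = ∑ ρ, pd h ρ (Φ z) * pd (fun w => Φ w ρ) i z := by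
  have h1 : fderiv ℝ (fun w => h (Φ w)) z = (fderiv ℝ h (Φ z)).comp (fderiv ℝ Φ z) :=
    fderiv_comp z hh hΦ
  have h2 : ∀ ρ, pd (fun w => Φ w ρ) i z = fderiv ℝ Φ z (EuclideanSpace.single i 1) ρ := by
    intro ρ
    have := ((EuclideanSpace.proj (𝕜 := ℝ) ρ).hasFDerivAt.comp z hΦ.hasFDerivAt).fderiv
    unfold pd
    erw [this]
    rfl
  simp_rw [h2]
  rw [← fderiv_eq_sum_pd]
  unfold pd
  rw [h1]
  rfl

lemma pd_congr {f g : EuclideanSpace ℝ (Fin n) → ℝ} {y : EuclideanSpace ℝ (Fin n)}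
    (h : f =ᶠ[nhds y] g) (α : Fin n) : pd f α y = pd g α y := by
  unfold pd
  rw [h.fderiv_eq]

lemma pd_const (c : ℝ) (α : Fin n) (y : EuclideanSpace ℝ (Fin n)) : pd (fun _ => c) α y = 0 := by
  simp [pd]

lemma pd_sub {f g : EuclideanSpace ℝ (Fin n) → ℝ} {y : EuclideanSpace ℝ (Fin n)}
    (hf : DifferentiableAt ℝ f y) (hg : DifferentiableAt ℝ g y) (α : Fin n) :
    pd (fun z => f z - g z) α y = pd f α y - pd g α y := by
  unfold pd
  rw [fderiv_fun_sub hf hg]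
  rfl

lemma pd_mul {f g : EuclideanSpace ℝ (Fin n) → ℝ} {y : EuclideanSpace ℝ (Fin n)}
    (hf : DifferentiableAt ℝ f y) (hg : DifferentiableAt ℝ g y) (α : Fin n) :
    pd (fun z => f z * g z) α y = pd f α y * g y + f y * pd g α y := by
  unfold pd
  rw [fderiv_fun_mul hf hg]
  simp; ring

lemma pd_sum {ι : Type*} [Fintype ι] {f : ι → EuclideanSpace ℝ (Fin n) → ℝ}
    {y : EuclideanSpace ℝ (Fin n)} (hf : ∀ i, DifferentiableAt ℝ (f i) y) (α : Fin n) :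
    pd (fun z => ∑ i, f i z) α y = ∑ i, pd (f i) α y := by
  unfold pd
  rw [fderiv_fun_sum (fun i _ => hf i)]
  simp

lemma continuousAt_pd {f : EuclideanSpace ℝ (Fin n) → ℝ} {U : Set (EuclideanSpace ℝ (Fin n))}
    {y : EuclideanSpace ℝ (Fin n)} (hf : ContDiffOn ℝ ∞ f U) (hU : IsOpen U) (hy : y ∈ U)
    (α : Fin n) : ContinuousAt (pd f α) y :=
  (((hf.continuousOn_fderiv_of_isOpen hU (by simp)).continuousAt (hU.mem_nhds hy))).clm_apply
    continuousAt_const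

lemma differentiableAt_pd {f : EuclideanSpace ℝ (Fin n) → ℝ}
    {U : Set (EuclideanSpace ℝ (Fin n))} {y : EuclideanSpace ℝ (Fin n)}
    (hf : ContDiffOn ℝ ∞ f U) (hU : IsOpen U) (hy : y ∈ U) (α : Fin n) :
    DifferentiableAt ℝ (pd f α) y :=
  (((hf.fderiv_of_isOpen (m := 1) hU (by norm_cast)).differentiableOn (by simp)).differentiableAt
    (hU.mem_nhds hy)).clm_apply (differentiableAt_const _)

lemma continuousAt_christoffel {G : EuclideanSpace ℝ (Fin n) → Matrix (Fin n) (Fin n) ℝ}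
    {U : Set (EuclideanSpace ℝ (Fin n))} {y : EuclideanSpace ℝ (Fin n)}
    (hG : ∀ a b, ContDiffOn ℝ ∞ (fun z => G z a b) U) (hU : IsOpen U) (hy : y ∈ U)
    (hdet : (G y).det ≠ 0) (α β γ : Fin n) :
    ContinuousAt (fun z => christoffel G z α β γ) y := by
  have hGc : ContinuousAt G y := by
    refine continuousAt_pi.2 fun a => continuousAt_pi.2 fun b => ?_
    exact (hG a b).continuousOn.continuousAt (hU.mem_nhds hy)
  have hinv : ∀ a b, ContinuousAt (fun z => (G z)⁻¹ a b) y := by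
    intro a b
    have h1 : ContinuousAt (fun z => (G z).det) y :=
      (continuous_id.matrix_det).continuousAt.comp hGc
    have h2 : ContinuousAt (fun z => (G z).adjugate a b) y :=
      ((continuous_id.matrix_adjugate).matrix_elem a b).continuousAt.comp hGc
    -- Cramer's formula: the inverse is continuous wherever the determinant does not vanish.
    have : (fun z => (G z)⁻¹ a b) = fun z => (G z).det⁻¹ * (G z).adjugate a b := by
      ext z
      simp [Matrix.inv_def]
    rw [this]
    exact (h1.inv₀ hdet).mul h2
  unfold christoffel
  refine continuousAt_const.mul (tendsto_finsetSum _ fun δ _ => (hinv α δ).mul ?_)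
  exact ((continuousAt_pd (hG _ _) hU hy _).add (continuousAt_pd (hG _ _) hU hy _)).sub
    (continuousAt_pd (hG _ _) hU hy _)

lemma sum_mul_christoffel {G : EuclideanSpace ℝ (Fin n) → Matrix (Fin n) (Fin n) ℝ}
    {y : EuclideanSpace ℝ (Fin n)} (hdet : (G y).det ≠ 0) (μ β γ : Fin n) :
    ∑ α, G y μ α * christoffel G y α β γ = (1 / 2) *
      (pd (fun z => G z μ γ) β y + pd (fun z => G z μ β) γ y - pd (fun z => G z β γ) μ y) := by
  set f : Fin n → ℝ := fun δ =>
    pd (fun z => G z δ γ) β y + pd (fun z => G z δ β) γ y - pd (fun z => G z β γ) δ y with hf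
  have h1 : ∀ α, christoffel G y α β γ = (1 / 2) * ((G y)⁻¹.mulVec f) α := fun α => rfl
  have h2 : (G y).mulVec ((G y)⁻¹.mulVec f) = f := by
    rw [Matrix.mulVec_mulVec, Matrix.mul_nonsing_inv _ (isUnit_iff_ne_zero.2 hdet),
      Matrix.one_mulVec]
  have h3 := congrFun h2 μ
  simp only [h1]
  change _ = (1 / 2) * f μ
  rw [← h3]
  simp only [Matrix.mulVec, dotProduct, Finset.mul_sum]
  exact Finset.sum_congr rfl fun α _ => Finset.sum_congr rfl fun β _ => by ring

/-- Metric compatibility of the Levi-Civita connection. -/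
lemma pd_metric_eq {G : EuclideanSpace ℝ (Fin n) → Matrix (Fin n) (Fin n) ℝ}
    {y : EuclideanSpace ℝ (Fin n)} (hdet : (G y).det ≠ 0)
    (hsymm : ∀ᶠ z in nhds y, ∀ a b, G z a b = G z b a) (a b ρ : Fin n) :
    pd (fun z => G z a b) ρ y = ∑ c, G y a c * christoffel G y c ρ b
      + ∑ c, G y b c * christoffel G y c ρ a := by
  have hs : ∀ a b ρ, pd (fun z => G z a b) ρ y = pd (fun z => G z b a) ρ y := fun a b ρ =>
    pd_congr (hsymm.mono fun z hz => hz a b) ρ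
  rw [sum_mul_christoffel hdet, sum_mul_christoffel hdet, hs b a ρ, hs b ρ a, hs a ρ b]
  ring

/-- Bridge between the Hessian as the field equations state it and second partial derivatives; at
rank 0 the connection sum is empty. -/
lemma covD_covD_scalar (G : EuclideanSpace ℝ (Fin n) → Matrix (Fin n) (Fin n) ℝ)
    (f : EuclideanSpace ℝ (Fin n) → ℝ) (y : EuclideanSpace ℝ (Fin n)) (a b : Fin n) :
    covD G (covD G (fun z (_ : Fin 0 → Fin n) => f z)) y ![a, b]
      = pd (pd f b) a y - ∑ σ, christoffel G y σ a b * pd f σ y := by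
  simp [covD, Fin.tail]

end CoordinateCalculus

/-! ### Orthogonality to hyperplanes under a nondegenerate form. -/

section LinearAlgebra

variable {V W : Type*} [AddCommGroup V] [Module ℝ V] [AddCommGroup W] [Module ℝ W]
  [FiniteDimensional ℝ V]

/-- A vector orthogonal to a hyperplane (the range of `f`) and to a further vector `v` outside it
vanishes. -/
lemma eq_zero_of_orthogonal_hyperplane_of_orthogonal (B : V →ₗ[ℝ] V →ₗ[ℝ] ℝ)
    (hB : ∀ b, (∀ v, B b v = 0) → b = 0) (f : W →ₗ[ℝ] V) (hf : Function.Injective f)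
    (hdim : Module.finrank ℝ W + 1 = Module.finrank ℝ V) {v b : V} (hv : v ∉ LinearMap.range f)
    (hbf : ∀ X, B b (f X) = 0) (hbv : B b v = 0) : b = 0 := by
  refine hB b fun u => ?_
  have h1 : LinearMap.range f ≤ LinearMap.ker (B b) := by
    rintro _ ⟨X, rfl⟩
    exact hbf X
  -- The kernel strictly contains a subspace of codimension one, so it is the whole space.
  have h2 : LinearMap.range f < LinearMap.ker (B b) :=
    lt_of_le_of_ne h1 fun h => hv (h ▸ hbv)
  have h3 := Submodule.finrank_lt_finrank_of_lt h2
  rw [LinearMap.finrank_range_of_inj hf] at h3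
  have h4 : LinearMap.ker (B b) = ⊤ :=
    Submodule.eq_top_of_finrank_eq (le_antisymm (Submodule.finrank_le _) (by omega))
  have : u ∈ LinearMap.ker (B b) := h4 ▸ Submodule.mem_top
  exact this

/-- A null vector orthogonal to a positive definite hyperplane vanishes. -/
lemma eq_zero_of_null_of_orthogonal_hyperplane (B : V →ₗ[ℝ] V →ₗ[ℝ] ℝ)
    (hB : ∀ b, (∀ v, B b v = 0) → b = 0) (f : W →ₗ[ℝ] V)
    (hdim : Module.finrank ℝ W + 1 = Module.finrank ℝ V)
    (hpos : ∀ X, X ≠ 0 → 0 < B (f X) (f X)) {b : V}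
    (hbf : ∀ X, B b (f X) = 0) (hbb : B b b = 0) : b = 0 := by
  have hf : Function.Injective f := by
    refine (injective_iff_map_eq_zero f).2 fun X hX => ?_
    by_contra hne
    have := hpos X hne
    simp [hX] at this
  by_cases hb : b ∈ LinearMap.range f
  · obtain ⟨X, rfl⟩ := hb
    by_contra hne
    have hX : X ≠ 0 := by
      rintro rfl
      simp at hne
    exact (hpos X hX).ne' (hbf X)
  -- Being null, `b` itself serves as the vector outside the hyperplane to which `b` is orthogonal.
  · exact eq_zero_of_orthogonal_hyperplane_of_orthogonal B hB f hf hdim hb hbf hbb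

end LinearAlgebra

/-! ### Covariant derivatives along a hypersurface, in coordinates. -/

section Hypersurface

variable {G : EuclideanSpace ℝ (Fin 4) → Matrix (Fin 4) (Fin 4) ℝ}
  {Φ : EuclideanSpace ℝ (Fin 3) → EuclideanSpace ℝ (Fin 4)}
  {N : EuclideanSpace ℝ (Fin 3) → Fin 4 → ℝ} {z : EuclideanSpace ℝ (Fin 3)}

/-- The covariant derivative `∇_i N^μ` of a vector field `N` along `Φ`. -/
noncomputable def covAlong (G : EuclideanSpace ℝ (Fin 4) → Matrix (Fin 4) (Fin 4) ℝ)
    (Φ : EuclideanSpace ℝ (Fin 3) → EuclideanSpace ℝ (Fin 4))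
    (N : EuclideanSpace ℝ (Fin 3) → Fin 4 → ℝ) (z : EuclideanSpace ℝ (Fin 3))
    (i : Fin 3) (μ : Fin 4) : ℝ :=
  pd (fun w => N w μ) i z
    + ∑ ρ, ∑ σ, christoffel G (Φ z) μ ρ σ * pd (fun w => Φ w ρ) i z * N z σ

/-- Metric compatibility: lowering an index commutes with ∇_i, so ∂_i N_a is (∇_i N)_a plus the
covector connection term Γ^c_{ia} N_c. -/
lemma pd_lower_along (hΦ : DifferentiableAt ℝ Φ z)
    (hN : ∀ μ, DifferentiableAt ℝ (fun w => N w μ) z)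
    (hG : ∀ a b, DifferentiableAt ℝ (fun y => G y a b) (Φ z)) (hdet : (G (Φ z)).det ≠ 0)
    (hsymm : ∀ᶠ y in nhds (Φ z), ∀ a b, G y a b = G y b a) (i : Fin 3) (a : Fin 4) :
    pd (fun w => ∑ b, G (Φ w) a b * N w b) i z = ∑ b, G (Φ z) a b * covAlong G Φ N z i b
      + ∑ ρ, ∑ c, christoffel G (Φ z) c ρ a * pd (fun w => Φ w ρ) i z
          * ∑ b, G (Φ z) c b * N z b := by
  have hGΦ : ∀ a b, DifferentiableAt ℝ (fun w => G (Φ w) a b) z := fun a b =>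
    (hG a b).comp z hΦ
  have hs := hsymm.self_of_nhds
  rw [pd_sum (f := fun b w => G (Φ w) a b * N w b) (fun b => (hGΦ a b).fun_mul (hN b))]
  have h1 : ∀ b, pd (fun w => G (Φ w) a b * N w b) i z
      = (∑ ρ, (∑ c, G (Φ z) a c * christoffel G (Φ z) c ρ b
          + ∑ c, G (Φ z) b c * christoffel G (Φ z) c ρ a) * pd (fun w => Φ w ρ) i z) * N z b
        + G (Φ z) a b * pd (fun w => N w b) i z := by
    intro b
    rw [pd_mul (hGΦ a b) (hN b), pd_comp (h := fun y => G y a b) (hG a b) hΦ]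
    simp only [pd_metric_eq hdet hsymm]
  simp only [h1, covAlong]
  simp only [mul_add, add_mul, Finset.sum_add_distrib, Finset.mul_sum, Finset.sum_mul]
  have e1 : ∑ b, ∑ ρ, ∑ c, G (Φ z) a c * christoffel G (Φ z) c ρ b
        * pd (fun w => Φ w ρ) i z * N z b
      = ∑ b, ∑ ρ, ∑ σ, G (Φ z) a b * (christoffel G (Φ z) b ρ σ
        * pd (fun w => Φ w ρ) i z * N z σ) := by
    rw [Finset.sum_comm]
    conv_rhs => rw [Finset.sum_comm]
    refine Finset.sum_congr rfl fun ρ _ => ?_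
    rw [Finset.sum_comm]
    exact Finset.sum_congr rfl fun _ _ => Finset.sum_congr rfl fun _ _ => by ring
  have e2 : ∑ b, ∑ ρ, ∑ c, G (Φ z) b c * christoffel G (Φ z) c ρ a
        * pd (fun w => Φ w ρ) i z * N z b
      = ∑ ρ, ∑ c, ∑ b, christoffel G (Φ z) c ρ a * pd (fun w => Φ w ρ) i z
          * (G (Φ z) c b * N z b) := by
    rw [Finset.sum_comm]
    refine Finset.sum_congr rfl fun ρ _ => ?_
    rw [Finset.sum_comm]
    refine Finset.sum_congr rfl fun c _ => Finset.sum_congr rfl fun b _ => ?_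
    rw [hs b c]
    ring
  rw [e1, e2]
  ring

/-- Differentiating N^a N_a = 1 gives 2 g(∇_i N, N) = 0: the connection terms from N^a and from N_a
cancel (`e3`). -/
lemma covAlong_orthogonal_of_unit (hΦ : DifferentiableAt ℝ Φ z)
    (hN : ∀ μ, DifferentiableAt ℝ (fun w => N w μ) z)
    (hG : ∀ a b, DifferentiableAt ℝ (fun y => G y a b) (Φ z)) (hdet : (G (Φ z)).det ≠ 0)
    (hsymm : ∀ᶠ y in nhds (Φ z), ∀ a b, G y a b = G y b a)
    (hunit : ∀ᶠ w in nhds z, ∑ a, ∑ b, G (Φ w) a b * N w a * N w b = 1) (i : Fin 3) :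
    ∑ a, ∑ b, G (Φ z) a b * covAlong G Φ N z i a * N z b = 0 := by
  have hGΦ : ∀ a b, DifferentiableAt ℝ (fun w => G (Φ w) a b) z := fun a b =>
    (hG a b).comp z hΦ
  have hs := hsymm.self_of_nhds
  have h0 : pd (fun w => ∑ a, N w a * ∑ b, G (Φ w) a b * N w b) i z = 0 := by
    rw [← pd_const 1 i z]
    refine pd_congr (hunit.mono fun w hw => ?_) i
    rw [← hw]
    simp only [Finset.mul_sum]
    exact Finset.sum_congr rfl fun _ _ => Finset.sum_congr rfl fun _ _ => by ring
  have hd : ∀ a, DifferentiableAt ℝ (fun w => ∑ b, G (Φ w) a b * N w b) z := fun a =>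
    DifferentiableAt.fun_sum fun b _ => (hGΦ a b).fun_mul (hN b)
  rw [pd_sum fun a => (hN a).fun_mul (hd a)] at h0
  simp only [pd_mul (hN _) (hd _), pd_lower_along hΦ hN hG hdet hsymm] at h0
  have e : ∀ a, pd (fun w => N w a) i z = covAlong G Φ N z i a
      - ∑ ρ, ∑ σ, christoffel G (Φ z) a ρ σ * pd (fun w => Φ w ρ) i z * N z σ := fun a => by
    simp [covAlong]
  simp only [e] at h0
  have e1 : ∑ a, N z a * ∑ b, G (Φ z) a b * covAlong G Φ N z i b
      = ∑ a, ∑ b, G (Φ z) a b * covAlong G Φ N z i a * N z b := by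
    simp only [Finset.mul_sum]
    rw [Finset.sum_comm]
    refine Finset.sum_congr rfl fun a _ => Finset.sum_congr rfl fun b _ => ?_
    rw [hs b a]
    ring
  have e2 : ∑ a, covAlong G Φ N z i a * ∑ b, G (Φ z) a b * N z b
      = ∑ a, ∑ b, G (Φ z) a b * covAlong G Φ N z i a * N z b := by
    simp only [Finset.mul_sum]
    exact Finset.sum_congr rfl fun _ _ => Finset.sum_congr rfl fun _ _ => by ring
  have e3 : ∑ a, (∑ ρ, ∑ σ, christoffel G (Φ z) a ρ σ * pd (fun w => Φ w ρ) i z * N z σ)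
        * ∑ b, G (Φ z) a b * N z b
      = ∑ a, N z a * ∑ ρ, ∑ c, christoffel G (Φ z) c ρ a * pd (fun w => Φ w ρ) i z
          * ∑ b, G (Φ z) c b * N z b := by
    -- The lowered vector N_c is made opaque so that distributing the sums does not expand it.
    generalize hP : (fun c => ∑ b, G (Φ z) c b * N z b) = P
    have hP' : ∀ c, ∑ b, G (Φ z) c b * N z b = P c := fun c => congrFun hP c
    simp only [hP', Finset.mul_sum, Finset.sum_mul]
    rw [Finset.sum_comm]
    conv_rhs => rw [Finset.sum_comm]
    refine Finset.sum_congr rfl fun ρ _ => ?_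
    rw [Finset.sum_comm]
    exact Finset.sum_congr rfl fun _ _ => Finset.sum_congr rfl fun _ _ => by ring
  simp only [sub_mul, mul_add, Finset.sum_add_distrib, Finset.sum_sub_distrib] at h0
  rw [e1, e2, e3] at h0
  linarith

/-- The defect `∂_a Ξ - Σ N_a`, whose pull-back to the hypersurface is the differential of the
restriction of `Ξ`. -/
noncomputable def gradDefect (G : EuclideanSpace ℝ (Fin 4) → Matrix (Fin 4) (Fin 4) ℝ)
    (Φ : EuclideanSpace ℝ (Fin 3) → EuclideanSpace ℝ (Fin 4))
    (N : EuclideanSpace ℝ (Fin 3) → Fin 4 → ℝ) (ξ : EuclideanSpace ℝ (Fin 4) → ℝ) (Sg : ℝ)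
    (z : EuclideanSpace ℝ (Fin 3)) (a : Fin 4) : ℝ :=
  pd ξ a (Φ z) - Sg * ∑ b, G (Φ z) a b * N z b

lemma pd_comp_eq_sum_gradDefect {ξ : EuclideanSpace ℝ (Fin 4) → ℝ} {Sg : ℝ}
    (hΦ : DifferentiableAt ℝ Φ z) (hξ : DifferentiableAt ℝ ξ (Φ z)) {i : Fin 3}
    (hperp : ∑ a, ∑ b, G (Φ z) a b * N z b * pd (fun w => Φ w a) i z = 0) :
    pd (fun w => ξ (Φ w)) i z
      = ∑ a, pd (fun w => Φ w a) i z * gradDefect G Φ N ξ Sg z a := by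
  rw [pd_comp hξ hΦ]
  simp only [gradDefect, mul_sub, Finset.sum_sub_distrib]
  have : ∑ a, pd (fun w => Φ w a) i z * (Sg * ∑ b, G (Φ z) a b * N z b) = Sg * 0 := by
    rw [← hperp]
    simp only [Finset.mul_sum]
    exact Finset.sum_congr rfl fun _ _ => Finset.sum_congr rfl fun _ _ => by ring
  rw [this]
  simp [mul_comm]

/-- The cancellation behind the theorem: the trace part Σκ g of the Hessian equals Σ times the
lowered ∇_i N = κ ∂_i Φ. What remains is linear and homogeneous in ξ and the defect. -/
lemma pd_gradDefect {ξ : EuclideanSpace ℝ (Fin 4) → ℝ} {Sg κ : ℝ} {l t : Fin 4 → Fin 4 → ℝ}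
    (hΦ : DifferentiableAt ℝ Φ z) (hN : ∀ μ, DifferentiableAt ℝ (fun w => N w μ) z)
    (hG : ∀ a b, DifferentiableAt ℝ (fun y => G y a b) (Φ z)) (hdet : (G (Φ z)).det ≠ 0)
    (hsymm : ∀ᶠ y in nhds (Φ z), ∀ a b, G y a b = G y b a)
    (hξ : ∀ a, DifferentiableAt ℝ (pd ξ a) (Φ z))
    (hess : ∀ a b, pd (pd ξ b) a (Φ z) - ∑ σ, christoffel G (Φ z) σ a b * pd ξ σ (Φ z)
      = -ξ (Φ z) * l a b + (Sg * κ) * G (Φ z) a b + (1 / 2) * ξ (Φ z) ^ 3 * t a b)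
    {i : Fin 3} (hW : ∀ μ, covAlong G Φ N z i μ = κ * pd (fun w => Φ w μ) i z) (a : Fin 4) :
    pd (fun w => gradDefect G Φ N ξ Sg w a) i z
      = (∑ ρ, (-l ρ a + (1 / 2) * ξ (Φ z) ^ 2 * t ρ a) * pd (fun w => Φ w ρ) i z) * ξ (Φ z)
        + ∑ c, (∑ ρ, christoffel G (Φ z) c ρ a * pd (fun w => Φ w ρ) i z)
            * gradDefect G Φ N ξ Sg z c := by
  have hGΦ : ∀ a b, DifferentiableAt ℝ (fun w => G (Φ w) a b) z := fun a b =>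
    (hG a b).comp z hΦ
  have hd : DifferentiableAt ℝ (fun w => ∑ b, G (Φ w) a b * N w b) z :=
    DifferentiableAt.fun_sum fun b _ => (hGΦ a b).fun_mul (hN b)
  have hs := hsymm.self_of_nhds
  have h1 : pd (fun w => gradDefect G Φ N ξ Sg w a) i z
      = ∑ ρ, pd (pd ξ a) ρ (Φ z) * pd (fun w => Φ w ρ) i z
        - Sg * (∑ b, G (Φ z) a b * (κ * pd (fun w => Φ w b) i z)
          + ∑ ρ, ∑ c, christoffel G (Φ z) c ρ a * pd (fun w => Φ w ρ) i z
            * ∑ b, G (Φ z) c b * N z b) := by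
    unfold gradDefect
    rw [pd_sub (f := fun w => pd ξ a (Φ w)) ((hξ a).comp z hΦ) ((differentiableAt_const Sg).fun_mul hd),
      pd_mul (differentiableAt_const Sg) hd, pd_const, pd_comp (hξ a) hΦ,
      pd_lower_along hΦ hN hG hdet hsymm]
    simp only [hW]
    ring
  -- One factor ξ is split off the cubic matter term; the remaining ξ² is treated as part of a known
  -- coefficient, which keeps the system linear.
  have h2 : ∀ ρ, pd (pd ξ a) ρ (Φ z) = ∑ σ, christoffel G (Φ z) σ ρ a * pd ξ σ (Φ z)
      + (-l ρ a + (1 / 2) * ξ (Φ z) ^ 2 * t ρ a) * ξ (Φ z) + Sg * κ * G (Φ z) a ρ := by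
    intro ρ
    have := hess ρ a
    rw [hs ρ a] at this
    linear_combination this
  rw [h1]
  simp only [h2, gradDefect, add_mul, mul_sub, Finset.sum_add_distrib, Finset.sum_sub_distrib]
  generalize hP : (fun c => ∑ b, G (Φ z) c b * N z b) = P
  have hP' : ∀ c, ∑ b, G (Φ z) c b * N z b = P c := fun c => congrFun hP c
  simp only [hP']
  have e1 : ∑ ρ, (∑ σ, christoffel G (Φ z) σ ρ a * pd ξ σ (Φ z)) * pd (fun w => Φ w ρ) i z
      = ∑ c, (∑ ρ, christoffel G (Φ z) c ρ a * pd (fun w => Φ w ρ) i z) * pd ξ c (Φ z) := by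
    simp only [Finset.sum_mul]
    rw [Finset.sum_comm]
    exact Finset.sum_congr rfl fun _ _ => Finset.sum_congr rfl fun _ _ => by ring
  have e2 : Sg * ∑ ρ, ∑ c, christoffel G (Φ z) c ρ a * pd (fun w => Φ w ρ) i z * P c
      = ∑ c, (∑ ρ, christoffel G (Φ z) c ρ a * pd (fun w => Φ w ρ) i z) * (Sg * P c) := by
    simp only [Finset.sum_mul, Finset.mul_sum]
    rw [Finset.sum_comm]
    exact Finset.sum_congr rfl fun _ _ => Finset.sum_congr rfl fun _ _ => by ring
  have e3 : ∑ ρ, Sg * κ * G (Φ z) a ρ * pd (fun w => Φ w ρ) i z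
      = Sg * ∑ b, G (Φ z) a b * (κ * pd (fun w => Φ w b) i z) := by
    simp only [Finset.mul_sum]
    exact Finset.sum_congr rfl fun _ _ => by ring
  rw [e1, e3, mul_add, e2]
  simp only [Finset.sum_mul]
  have e4 : ∀ x y : Fin 4 → ℝ, ∑ ρ, x ρ * ξ (Φ z) * y ρ = ∑ ρ, x ρ * y ρ * ξ (Φ z) :=
    fun x y => Finset.sum_congr rfl fun _ _ => by ring
  rw [e4, e4]
  ring

end Hypersurface

/-! ### Grönwall argument and connectedness. -/

section UniqueContinuation

variable {m : ℕ} {β : Type*} [Fintype β]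

/-- Unique continuation for linear systems of total differential equations: near `z₀` a solution of
`∂_i u_α = C_{iαβ} u_β` that vanishes at one point vanishes identically. -/
lemma exists_nhds_eq_zero_of_pd_linear (u : EuclideanSpace ℝ (Fin m) → β → ℝ)
    (C : Fin m → β → β → EuclideanSpace ℝ (Fin m) → ℝ) (z₀ : EuclideanSpace ℝ (Fin m))
    (hu : ∀ᶠ z in nhds z₀, ∀ α, DifferentiableAt ℝ (fun w => u w α) z)
    (hC : ∀ i α β, ContinuousAt (C i α β) z₀)
    (hlin : ∀ᶠ z in nhds z₀, ∀ i α, pd (fun w => u w α) i z = ∑ β, C i α β z * u z β) :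
    ∃ W ∈ nhds z₀, ∀ z ∈ W, ∀ z' ∈ W, u z = 0 → u z' = 0 := by
  obtain ⟨K, hK0, hK⟩ : ∃ K : ℝ, 0 ≤ K ∧ ∀ᶠ z in nhds z₀, ∀ i α β, |C i α β z| ≤ K := by
    -- Each summand bounds its own coefficient near z₀ by continuity, and all summands are positive,
    -- so the sum bounds every coefficient.
    refine ⟨∑ i, ∑ α, ∑ β, (|C i α β z₀| + 1), by positivity, ?_⟩
    refine Filter.eventually_all.2 fun i => Filter.eventually_all.2 fun α =>
      Filter.eventually_all.2 fun β => ?_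
    have h1 : ∀ᶠ z in nhds z₀, |C i α β z| < |C i α β z₀| + 1 :=
      (hC i α β).abs.eventually_lt_const (by linarith)
    refine h1.mono fun z hz => hz.le.trans ?_
    refine (Finset.single_le_sum (f := fun β => |C i α β z₀| + 1)
      (fun _ _ => by positivity) (Finset.mem_univ β)).trans ?_
    refine (Finset.single_le_sum (f := fun α => ∑ β, (|C i α β z₀| + 1))
      (fun _ _ => by positivity) (Finset.mem_univ α)).trans ?_
    exact Finset.single_le_sum (f := fun i => ∑ α, ∑ β, (|C i α β z₀| + 1))
      (fun _ _ => by positivity) (Finset.mem_univ i)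
  obtain ⟨r, hr, hball⟩ := Metric.eventually_nhds_iff_ball.1 (hu.and (hlin.and hK))
  refine ⟨Metric.ball z₀ r, Metric.ball_mem_nhds _ hr, fun z hz z' hz' h0 => ?_⟩
  set v := z' - z with hv
  have hmem : ∀ t ∈ Set.Icc (0 : ℝ) 1, z + t • v ∈ Metric.ball z₀ r := fun t ht => by
    have := (convex_ball z₀ r).add_smul_sub_mem hz hz' ht
    simpa [hv] using this
  have hderiv : ∀ t ∈ Set.Icc (0 : ℝ) 1, HasDerivAt (fun t : ℝ => u (z + t • v))
      (fun α => fderiv ℝ (fun w => u w α) (z + t • v) v) t := by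
    intro t ht
    refine hasDerivAt_pi.2 fun α => ?_
    have h1 := ((hball _ (hmem t ht)).1 α).hasFDerivAt
    have h2 : HasDerivAt (fun t : ℝ => z + t • v) v t := by
      simpa using ((hasDerivAt_id t).smul_const v).const_add z
    exact h1.comp_hasDerivAt t h2
  -- Growth rate in the sup norm along the segment: the ℓ¹ norm of the direction, times the number
  -- of unknowns, times the coefficient bound.
  set K' := (∑ i, |v i|) * ((Fintype.card β : ℝ) * K) with hK'
  have hbound : ∀ t ∈ Set.Ico (0 : ℝ) 1,
      ‖fun α => fderiv ℝ (fun w => u w α) (z + t • v) v‖ ≤ K' * ‖u (z + t • v)‖ := by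
    intro t ht
    obtain ⟨-, h2, h3⟩ := hball _ (hmem t (Set.Ico_subset_Icc_self ht))
    refine (pi_norm_le_iff_of_nonneg (by positivity)).2 fun α => ?_
    rw [fderiv_eq_sum_pd, Real.norm_eq_abs, hK', Finset.sum_mul, Finset.sum_mul]
    refine (Finset.abs_sum_le_sum_abs _ _).trans (Finset.sum_le_sum fun i _ => ?_)
    rw [abs_mul, mul_comm, mul_assoc]
    refine mul_le_mul_of_nonneg_left ?_ (abs_nonneg _)
    rw [h2]
    calc |∑ β, C i α β (z + t • v) * u (z + t • v) β|
        ≤ ∑ β, |C i α β (z + t • v) * u (z + t • v) β| := Finset.abs_sum_le_sum_abs _ _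
      _ ≤ ∑ _β : β, K * ‖u (z + t • v)‖ := by
          refine Finset.sum_le_sum fun β _ => ?_
          rw [abs_mul]
          exact mul_le_mul (h3 i α β) (norm_le_pi_norm (u (z + t • v)) β) (abs_nonneg _) hK0
      _ = (Fintype.card β : ℝ) * K * ‖u (z + t • v)‖ := by simp [mul_assoc]
  -- Grönwall along the segment from z to z', which stays in the ball by convexity.
  have := eq_zero_of_abs_deriv_le_mul_abs_self_of_eq_zero_right
    (f := fun t : ℝ => u (z + t • v)) (a := 0) (b := 1) (K := K')
    (fun t ht => (hderiv t ht).continuousAt.continuousWithinAt)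
    (fun t ht => (hderiv t (Set.Ico_subset_Icc_self ht)).hasDerivWithinAt)
    (by simpa using h0) hbound 1 (by simp)
  simpa [hv] using this

/-- A set such that every point has a neighbourhood contained in it or in its complement is
everything, if it meets a connected space. -/
lemma mem_of_locally_constant {X : Type*} [TopologicalSpace X] [PreconnectedSpace X] {Z : Set X}
    (h : ∀ p, ∃ W ∈ nhds p, ∀ q ∈ W, ∀ q' ∈ W, q ∈ Z → q' ∈ Z) (hZ : Z.Nonempty) (p : X) :
    p ∈ Z := by
  have ho : IsOpen Z := by
    refine isOpen_iff_mem_nhds.2 fun q hq => ?_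
    obtain ⟨W, hW, hWZ⟩ := h q
    exact Filter.mem_of_superset hW fun q' hq' => hWZ q (mem_of_mem_nhds hW) q' hq' hq
  have hc : IsOpen Zᶜ := by
    refine isOpen_iff_mem_nhds.2 fun q hq => ?_
    obtain ⟨W, hW, hWZ⟩ := h q
    exact Filter.mem_of_superset hW fun q' hq' hZ' => hq (hWZ q' hq' q (mem_of_mem_nhds hW) hZ')
  have := IsClopen.eq_univ ⟨⟨hc⟩, ho⟩ hZ
  exact this ▸ Set.mem_univ p

end UniqueContinuation

/-! ### Two-tensors as bilinear forms. -/

section TensorAlgebra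

variable {V : Type*} [AddCommGroup V] [Module ℝ V]

/-- A multilinear map in two variables as a bilinear map. -/
noncomputable def bilinOfMultilinear (A : MultilinearMap ℝ (fun _ : Fin 2 => V) ℝ) :
    V →ₗ[ℝ] V →ₗ[ℝ] ℝ :=
  have hu : ∀ u v : V, ![u, v] = Function.update ![u, 0] 1 v := fun u v => by
    ext i; fin_cases i <;> rfl
  LinearMap.mk₂ ℝ (fun u v => A ![u, v]) (fun u u' v => A.cons_add ![v] u u')
    (fun c u v => A.cons_smul ![v] c u)
    (fun u v v' => by rw [hu u v, hu u v', hu u (v + v')]; exact A.map_update_add _ _ _ _)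
    (fun c u v => by rw [hu u v, hu u (c • v)]; exact A.map_update_smul _ _ _ _)

lemma bilinOfMultilinear_apply (A : MultilinearMap ℝ (fun _ : Fin 2 => V) ℝ) (u v : V) :
    bilinOfMultilinear A u v = A ![u, v] := rfl

lemma bilin_sum_sum {ι : Type*} [Fintype ι] (B : V →ₗ[ℝ] V →ₗ[ℝ] ℝ) (c : ι → V) (u v : ι → ℝ) :
    B (∑ a, u a • c a) (∑ b, v b • c b) = ∑ a, ∑ b, B (c a) (c b) * u a * v b := by
  simp only [map_sum, LinearMap.sum_apply, map_smul, LinearMap.smul_apply, smul_eq_mul]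
  simp only [Finset.mul_sum]
  rw [Finset.sum_comm]
  exact Finset.sum_congr rfl fun _ _ => Finset.sum_congr rfl fun _ _ => by ring

lemma euclidean_eq_sum_single {n : ℕ} (w : EuclideanSpace ℝ (Fin n)) :
    w = ∑ μ, w μ • EuclideanSpace.single μ (1 : ℝ) := by
  conv_lhs => rw [← (EuclideanSpace.basisFun (Fin n) ℝ).sum_repr w]
  simp

end TensorAlgebra

/-! ### Tangent vectors, tensors and differentials in a chart. -/

section Charts

variable {n : ℕ} {M : Type*} [TopologicalSpace M] [ChartedSpace (EuclideanSpace ℝ (Fin n)) M]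

lemma IsLorentzianAt.symm {g : CovTensor n M 2} {x : M} (h : IsLorentzianAt g x)
    (u v : TangentSpace (𝓡 n) x) : g x ![u, v] = g x ![v, u] := by
  obtain ⟨b, i₀, hb⟩ := h
  have : bilinOfMultilinear (g x) = (bilinOfMultilinear (g x)).flip := by
    refine b.ext fun i => b.ext fun j => ?_
    rw [LinearMap.flip_apply, bilinOfMultilinear_apply, bilinOfMultilinear_apply, hb, hb]
    by_cases hij : i = j
    · rw [hij]
    · rw [if_neg hij, if_neg (Ne.symm hij)]
  exact congrArg (fun B => B u v) this

lemma IsLorentzianAt.nondegenerate {g : CovTensor n M 2} {x : M} (h : IsLorentzianAt g x)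
    (u : TangentSpace (𝓡 n) x) (hu : ∀ v, g x ![u, v] = 0) : u = 0 := by
  obtain ⟨b, i₀, hb⟩ := h
  have h1 : ∀ j, b.repr u j = 0 := by
    intro j
    have h2 : bilinOfMultilinear (g x) u (b j) = 0 := hu (b j)
    rw [← b.sum_repr u] at h2
    simp only [map_sum, map_smul, LinearMap.sum_apply, LinearMap.smul_apply,
      bilinOfMultilinear_apply, hb, smul_eq_mul] at h2
    rw [Finset.sum_eq_single j (fun i _ hij => by simp [hij]) (by simp)] at h2
    split_ifs at h2 <;> simp_all
  rw [← b.sum_repr u]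
  simp [h1]

/-- The components of a tangent vector in the chart `e`. -/
noncomputable def chartVec (e : OpenPartialHomeomorph M (EuclideanSpace ℝ (Fin n))) {x : M}
    (v : TangentSpace (𝓡 n) x) : EuclideanSpace ℝ (Fin n) :=
  mfderiv (𝓡 n) (𝓡 n) e x v

/-- The differential of a scalar field, with values in `ℝ`. -/
noncomputable def differential (f : M → ℝ) {x : M} (v : TangentSpace (𝓡 n) x) : ℝ :=
  mfderiv (𝓡 n) 𝓘(ℝ, ℝ) f x v

variable [IsManifold (𝓡 n) ∞ M] {e : OpenPartialHomeomorph M (EuclideanSpace ℝ (Fin n))}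

lemma mdifferentiable_of_mem (he : e ∈ atlas (EuclideanSpace ℝ (Fin n)) M) :
    e.MDifferentiable (𝓡 n) (𝓡 n) := by
  have : IsManifold (𝓡 n) 1 M := IsManifold.of_le (n := ∞) (by norm_cast)
  exact mdifferentiable_of_mem_atlas he

lemma exists_chartVec_eq (he : e ∈ atlas (EuclideanSpace ℝ (Fin n)) M) {x : M}
    (hx : x ∈ e.source) (w : EuclideanSpace ℝ (Fin n)) :
    ∃ v : TangentSpace (𝓡 n) x, chartVec e v = w :=
  (mdifferentiable_of_mem he).mfderiv_surjective hx w

lemma sum_chartVec_smul_coordVec (he : e ∈ atlas (EuclideanSpace ℝ (Fin n)) M) {x : M}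
    (hx : x ∈ e.source) (v : TangentSpace (𝓡 n) x) :
    ∑ μ, chartVec e v μ • (coordVec e (e x) μ : EuclideanSpace ℝ (Fin n)) = v := by
  have h1 := (mdifferentiable_of_mem he).symm_comp_deriv hx
  have h2 : (mfderiv (𝓡 n) (𝓡 n) e.symm (e x) (mfderiv (𝓡 n) (𝓡 n) e x v) :
      EuclideanSpace ℝ (Fin n)) = v := congrArg (fun f => f v) h1
  conv_rhs => rw [← h2]
  have h3 : (mfderiv (𝓡 n) (𝓡 n) e x v : EuclideanSpace ℝ (Fin n))
      = ∑ μ, chartVec e v μ • EuclideanSpace.single μ (1 : ℝ) := euclidean_eq_sum_single _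
  let D : EuclideanSpace ℝ (Fin n) →L[ℝ] EuclideanSpace ℝ (Fin n) :=
    mfderiv (𝓡 n) (𝓡 n) e.symm (e x)
  change _ = D (mfderiv (𝓡 n) (𝓡 n) e x v : EuclideanSpace ℝ (Fin n))
  rw [h3, map_sum]
  refine Finset.sum_congr rfl fun μ _ => ?_
  rw [map_smul]
  rfl

-- Components live at `e.symm (e x)`, which equals `x` only propositionally; all tangent spaces
-- share one model space, so the same vectors can be fed in at both points.
omit [IsManifold (𝓡 n) ∞ M] in
lemma tensor_congr {k : ℕ} (A : CovTensor n M k) {x x' : M} (h : x' = x)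
    (v : Fin k → EuclideanSpace ℝ (Fin n)) :
    A x' (fun i => (v i : TangentSpace (𝓡 n) x')) = A x (fun i => (v i : TangentSpace (𝓡 n) x)) := by
  subst h
  rfl

lemma tensor_eq_sum_comp (A : CovTensor n M 2) (he : e ∈ atlas (EuclideanSpace ℝ (Fin n)) M)
    {x : M} (hx : x ∈ e.source) (u v : TangentSpace (𝓡 n) x) :
    A x ![u, v] = ∑ a, ∑ b, comp A e (e x) ![a, b] * chartVec e u a * chartVec e v b := by
  have h1 : ∀ a b, comp A e (e x) ![a, b]
      = bilinOfMultilinear (A x) (coordVec e (e x) a : EuclideanSpace ℝ (Fin n))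
        (coordVec e (e x) b : EuclideanSpace ℝ (Fin n)) := by
    intro a b
    refine (tensor_congr A (e.left_inv hx)
      (fun i => (coordVec e (e x) (![a, b] i) : EuclideanSpace ℝ (Fin n)))).trans ?_
    refine congrArg (A x) ?_
    ext i : 1
    fin_cases i <;> rfl
  have hu := sum_chartVec_smul_coordVec he hx u
  have hv := sum_chartVec_smul_coordVec he hx v
  simp only [h1]
  let B : EuclideanSpace ℝ (Fin n) →ₗ[ℝ] EuclideanSpace ℝ (Fin n) →ₗ[ℝ] ℝ :=
    bilinOfMultilinear (A x)
  exact (congrArg₂ (fun u v : EuclideanSpace ℝ (Fin n) => B u v) hu.symm hv.symm).trans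
    (bilin_sum_sum B (fun a => coordVec e (e x) a) (chartVec e u) (chartVec e v))

omit [IsManifold (𝓡 n) ∞ M] in
lemma compMatrix_symm {g : CovTensor n M 2} (hg : ∀ x, IsLorentzianAt g x)
    (y : EuclideanSpace ℝ (Fin n)) (a b : Fin n) :
    compMatrix g e y a b = compMatrix g e y b a := by
  have h := (hg (e.symm y)).symm (coordVec e y a) (coordVec e y b)
  simp only [compMatrix, Matrix.of_apply, comp]
  convert h using 2
  · ext i : 1; fin_cases i <;> rfl
  · ext i : 1; fin_cases i <;> rfl

/-- A null vector of the component matrix would be the chart image of a tangent vector orthogonal to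
everything. -/
lemma compMatrix_det_ne_zero {g : CovTensor n M 2} (hg : ∀ x, IsLorentzianAt g x)
    (he : e ∈ atlas (EuclideanSpace ℝ (Fin n)) M) {x : M} (hx : x ∈ e.source) :
    (compMatrix g e (e x)).det ≠ 0 := by
  intro h0
  obtain ⟨w, hw, hGw⟩ := Matrix.exists_vecMul_eq_zero_iff.2 h0
  obtain ⟨v, hv⟩ := exists_chartVec_eq he hx (WithLp.toLp 2 w)
  have h1 : v = 0 := by
    refine (hg x).nondegenerate v fun v' => ?_
    rw [tensor_eq_sum_comp g he hx, hv, Finset.sum_comm]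
    refine Finset.sum_eq_zero fun b _ => ?_
    rw [← Finset.sum_mul]
    have := congrFun hGw b
    simp only [Matrix.vecMul, dotProduct, compMatrix, Matrix.of_apply, Pi.zero_apply] at this
    simp only [mul_comm (comp g e _ _), this, zero_mul]
  apply hw
  have h2 : chartVec e v = 0 := by
    rw [h1]
    exact map_zero (mfderiv (𝓡 n) (𝓡 n) e x)
  rw [hv] at h2
  ext i
  exact congrArg (fun u : EuclideanSpace ℝ (Fin n) => u i) h2

lemma differential_eq_sum_pd {f : M → ℝ} (he : e ∈ atlas (EuclideanSpace ℝ (Fin n)) M) {x : M}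
    (hx : x ∈ e.source) (hf : MDifferentiableAt (𝓡 n) 𝓘(ℝ, ℝ) f x)
    (v : TangentSpace (𝓡 n) x) :
    differential f v = ∑ μ, pd (fun z => f (e.symm z)) μ (e x) * chartVec e v μ := by
  have hd := mdifferentiable_of_mem he
  have h1 : MDifferentiableAt (𝓡 n) 𝓘(ℝ, ℝ) (fun z => f (e.symm z)) (e x) := by
    have h2 : MDifferentiableAt (𝓡 n) 𝓘(ℝ, ℝ) f (e.symm (e x)) := by rwa [e.left_inv hx]
    exact h2.comp (e x) (hd.mdifferentiableAt_symm (e.map_source hx))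
  have h3 : f =ᶠ[nhds x] (fun z => f (e.symm z)) ∘ e := by
    filter_upwards [e.open_source.mem_nhds hx] with x' hx'
    simp [e.left_inv hx']
  rw [differential, h3.mfderiv_eq, mfderiv_comp x h1 (hd.mdifferentiableAt hx), mfderiv_eq_fderiv,
    ← fderiv_eq_sum_pd]
  rfl

end Charts

/-! ### Coordinate representations of a map and of vector fields along it. -/

section Maps

variable {m n : ℕ} {M : Type*} [TopologicalSpace M] [ChartedSpace (EuclideanSpace ℝ (Fin n)) M]
  [IsManifold (𝓡 n) ∞ M]
  {N : Type*} [TopologicalSpace N] [ChartedSpace (EuclideanSpace ℝ (Fin m)) N]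
  [IsManifold (𝓡 m) ∞ N]
  {e : OpenPartialHomeomorph M (EuclideanSpace ℝ (Fin n))}
  {e' : OpenPartialHomeomorph N (EuclideanSpace ℝ (Fin m))} {ι : N → M}

/-- The coordinates in the domain of `e'` of the points that `ι` maps to the domain of `e`. -/
def chartDomain (ι : N → M) (e : OpenPartialHomeomorph M (EuclideanSpace ℝ (Fin n)))
    (e' : OpenPartialHomeomorph N (EuclideanSpace ℝ (Fin m))) : Set (EuclideanSpace ℝ (Fin m)) :=
  e'.target ∩ e'.symm ⁻¹' (ι ⁻¹' e.source)

omit [ChartedSpace (EuclideanSpace ℝ (Fin n)) M] [IsManifold (𝓡 n) ∞ M]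
  [ChartedSpace (EuclideanSpace ℝ (Fin m)) N] [IsManifold (𝓡 m) ∞ N] in
lemma isOpen_chartDomain (hι : Continuous ι) : IsOpen (chartDomain ι e e') :=
  e'.isOpen_inter_preimage_symm (e.open_source.preimage hι)

lemma contDiffOn_chartRep (hι : ContMDiff (𝓡 m) (𝓡 n) ∞ ι)
    (he : e ∈ atlas (EuclideanSpace ℝ (Fin n)) M)
    (he' : e' ∈ atlas (EuclideanSpace ℝ (Fin m)) N) :
    ContDiffOn ℝ ∞ (fun z => e (ι (e'.symm z))) (chartDomain ι e e') := by
  rw [← contMDiffOn_iff_contDiffOn]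
  have h1 := contMDiffOn_of_mem_maximalAtlas (I := 𝓡 n) (n := ∞)
    (IsManifold.subset_maximalAtlas he)
  have h2 := contMDiffOn_symm_of_mem_maximalAtlas (I := 𝓡 m) (n := ∞)
    (IsManifold.subset_maximalAtlas he')
  exact h1.comp (hι.comp_contMDiffOn (h2.mono fun z hz => hz.1)) fun z hz => hz.2

lemma chartVec_mfderiv_coordVec (hι : ContMDiff (𝓡 m) (𝓡 n) ∞ ι)
    (he : e ∈ atlas (EuclideanSpace ℝ (Fin n)) M)
    (he' : e' ∈ atlas (EuclideanSpace ℝ (Fin m)) N) {z : EuclideanSpace ℝ (Fin m)}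
    (hz : z ∈ chartDomain ι e e') (i : Fin m) (μ : Fin n) :
    chartVec e (mfderiv (𝓡 m) (𝓡 n) ι (e'.symm z) (coordVec e' z i)) μ
      = pd (fun w => e (ι (e'.symm w)) μ) i z := by
  have hd := mdifferentiable_of_mem he
  have hd' := mdifferentiable_of_mem he'
  have h1 : MDifferentiableAt (𝓡 m) (𝓡 n) (fun w => ι (e'.symm w)) z :=
    (hι.mdifferentiable (by simp) _).comp z (hd'.mdifferentiableAt_symm hz.1)
  have h2 : mfderiv (𝓡 m) (𝓡 n) (fun w => e (ι (e'.symm w))) z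
      = (mfderiv (𝓡 n) (𝓡 n) e (ι (e'.symm z))).comp
        (mfderiv (𝓡 m) (𝓡 n) (fun w => ι (e'.symm w)) z) :=
    mfderiv_comp z (hd.mdifferentiableAt hz.2) h1
  have h3 : mfderiv (𝓡 m) (𝓡 n) (fun w => ι (e'.symm w)) z
      = (mfderiv (𝓡 m) (𝓡 n) ι (e'.symm z)).comp (mfderiv (𝓡 m) (𝓡 m) e'.symm z) :=
    mfderiv_comp z (hι.mdifferentiable (by simp) _) (hd'.mdifferentiableAt_symm hz.1)
  rw [h3] at h2
  have hdiff : DifferentiableAt ℝ (fun w => e (ι (e'.symm w))) z :=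
    ((contDiffOn_chartRep hι he he').differentiableOn (by simp)).differentiableAt
      ((isOpen_chartDomain hι.continuous).mem_nhds hz)
  have h4 : pd (fun w => e (ι (e'.symm w)) μ) i z
      = fderiv ℝ (fun w => e (ι (e'.symm w))) z (EuclideanSpace.single i 1) μ := by
    have := ((EuclideanSpace.proj (𝕜 := ℝ) μ).hasFDerivAt.comp z hdiff.hasFDerivAt).fderiv
    unfold pd
    erw [this]
    rfl
  rw [h4, ← mfderiv_eq_fderiv]
  erw [h2]
  rfl

/-- The chart is a preferred one, `chartAt _ x₀`, because its differential is the fibre coordinate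
of the tangent bundle's trivialization at `x₀`, through which smoothness of ν is read off. -/
lemma differentiableAt_chartVec_along {ν : ∀ p : N, TangentSpace (𝓡 n) (ι p)}
    (hν : ContMDiff (𝓡 m) (𝓡 n).tangent ∞ (fun p => (⟨ι p, ν p⟩ : TangentBundle (𝓡 n) M)))
    (hι : Continuous ι) (x₀ : M) (he' : e' ∈ atlas (EuclideanSpace ℝ (Fin m)) N)
    {z : EuclideanSpace ℝ (Fin m)} (hz : z ∈ chartDomain ι (chartAt (EuclideanSpace ℝ (Fin n)) x₀) e') (μ : Fin n) :
    DifferentiableAt ℝ (fun w => chartVec (chartAt (EuclideanSpace ℝ (Fin n)) x₀)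
      (ν (e'.symm w)) μ) z := by
  have : IsManifold (𝓡 n) 1 M := IsManifold.of_le (n := ∞) (by norm_cast)
  set t := trivializationAt (EuclideanSpace ℝ (Fin n)) (TangentSpace (𝓡 n) : M → Type _) x₀ with ht
  have h2 := contMDiffOn_symm_of_mem_maximalAtlas (I := 𝓡 m) (n := ∞)
    (IsManifold.subset_maximalAtlas he')
  have h3 : ContMDiffOn (𝓡 m) (𝓡 n).tangent ∞
      (fun w => (⟨ι (e'.symm w), ν (e'.symm w)⟩ : TangentBundle (𝓡 n) M))
      (chartDomain ι (chartAt (EuclideanSpace ℝ (Fin n)) x₀) e') :=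
    hν.comp_contMDiffOn (h2.mono fun z hz => hz.1)
  have hbase : t.baseSet = (chartAt (EuclideanSpace ℝ (Fin n)) x₀).source := rfl
  have h4 : ContMDiffOn (𝓡 m) ((𝓡 n).prod 𝓘(ℝ, EuclideanSpace ℝ (Fin n))) ∞
      (fun w => t (⟨ι (e'.symm w), ν (e'.symm w)⟩ : TangentBundle (𝓡 n) M))
      (chartDomain ι (chartAt (EuclideanSpace ℝ (Fin n)) x₀) e') := by
    refine (t.contMDiffOn (n := ∞)).comp h3 fun w hw => ?_
    rw [Set.mem_preimage, t.mem_source]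
    exact hw.2
  have h5 : ContMDiffOn (𝓡 m) 𝓘(ℝ, EuclideanSpace ℝ (Fin n)) ∞
      (fun w => (t (⟨ι (e'.symm w), ν (e'.symm w)⟩ : TangentBundle (𝓡 n) M)).2)
      (chartDomain ι (chartAt (EuclideanSpace ℝ (Fin n)) x₀) e') :=
    contMDiff_snd.comp_contMDiffOn h4
  have h6 : ContDiffOn ℝ ∞
      (fun w => chartVec (chartAt (EuclideanSpace ℝ (Fin n)) x₀) (ν (e'.symm w)))
      (chartDomain ι (chartAt (EuclideanSpace ℝ (Fin n)) x₀) e') := by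
    rw [← contMDiffOn_iff_contDiffOn]
    refine h5.congr fun w hw => ?_
    have h7 := TangentBundle.continuousLinearMapAt_trivializationAt (I := 𝓡 n) (x₀ := x₀) hw.2
    have h8 := congrArg (fun f => f (ν (e'.symm w))) h7
    rw [← t.continuousLinearMapAt_apply_of_mem ℝ hw.2]
    exact h8.symm
  have h9 := (h6.differentiableOn (by simp)).differentiableAt
    ((isOpen_chartDomain hι).mem_nhds hz)
  exact (EuclideanSpace.proj (𝕜 := ℝ) μ).differentiableAt.comp z h9

end Maps

/-! ### The boundary system, its zero set, and initial data on the spacelike surface. -/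

section Rigidity

variable {M : Type*} [TopologicalSpace M] [ChartedSpace (EuclideanSpace ℝ (Fin 4)) M]
  [IsManifold (𝓡 4) ∞ M]
  {N : Type*} [TopologicalSpace N] [ChartedSpace (EuclideanSpace ℝ (Fin 3)) N]
  [IsManifold (𝓡 3) ∞ N]
  {F : ConformalSpacetime M} {lam : ℝ} {ι : N → M} {ν : ∀ p : N, TangentSpace (𝓡 4) (ι p)}
  {κ : N → ℝ}

-- A vector killed by dι is orthogonal to everything in the induced metric, which is nondegenerate.
omit [IsManifold (𝓡 3) ∞ N] in
lemma IsTimelikeHypersurface.mfderiv_injective (hT : IsTimelikeHypersurface F ι ν) (p : N) :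
    Function.Injective (mfderiv (𝓡 3) (𝓡 4) ι p).toLinearMap := by
  refine (injective_iff_map_eq_zero _).2 fun X hX => ?_
  refine (hT.timelike p).nondegenerate X fun Y => ?_
  refine (F.g (ι p)).map_coord_zero (0 : Fin 2) ?_
  exact hX

-- The normal is transversal: if ν were tangent it would be orthogonal to itself, contradicting
-- g(ν,ν) = 1.
omit [IsManifold (𝓡 3) ∞ N] in
lemma IsTimelikeHypersurface.eq_zero_of_orthogonal (hT : IsTimelikeHypersurface F ι ν) (p : N)
    {b : TangentSpace (𝓡 4) (ι p)}
    (hb : ∀ X : TangentSpace (𝓡 3) p, F.g (ι p) ![b, mfderiv (𝓡 3) (𝓡 4) ι p X] = 0)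
    (hbν : F.g (ι p) ![b, ν p] = 0) : b = 0 := by
  have : FiniteDimensional ℝ (TangentSpace (𝓡 4) (ι p)) :=
    inferInstanceAs (FiniteDimensional ℝ (EuclideanSpace ℝ (Fin 4)))
  have h3 : Module.finrank ℝ (TangentSpace (𝓡 3) p) = 3 :=
    finrank_euclideanSpace_fin (𝕜 := ℝ) (n := 3)
  have h4 : Module.finrank ℝ (TangentSpace (𝓡 4) (ι p)) = 4 :=
    finrank_euclideanSpace_fin (𝕜 := ℝ) (n := 4)
  refine eq_zero_of_orthogonal_hyperplane_of_orthogonal (bilinOfMultilinear (F.g (ι p)))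
    (fun u hu => (F.lorentzian (ι p)).nondegenerate u hu) (mfderiv (𝓡 3) (𝓡 4) ι p).toLinearMap
    (hT.mfderiv_injective p) (by rw [h3, h4]) (v := ν p) ?_ hb hbν
  rintro ⟨X, hX⟩
  have h1 := hT.normal p X
  have h2 := hT.unit p
  have hX' : mfderiv (𝓡 3) (𝓡 4) ι p X = ν p := hX
  rw [hX', h2] at h1
  exact one_ne_zero h1

/-- The Weingarten equation of a totally umbilical hypersurface, `∇_i ν = κ ∂_i`. -/
lemma HasBoundaryFields.covAlong_normal (hB : HasBoundaryFields F lam ι ν κ)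
    (hT : IsTimelikeHypersurface F ι ν) (x₀ : M)
    {e' : OpenPartialHomeomorph N (EuclideanSpace ℝ (Fin 3))}
    (he' : e' ∈ atlas (EuclideanSpace ℝ (Fin 3)) N) {z : EuclideanSpace ℝ (Fin 3)}
    (hz : z ∈ chartDomain ι (chartAt (EuclideanSpace ℝ (Fin 4)) x₀) e') (i : Fin 3) (μ : Fin 4) :
    covAlong (compMatrix F.g (chartAt _ x₀))
        (fun w => chartAt (EuclideanSpace ℝ (Fin 4)) x₀ (ι (e'.symm w)))
        (fun w μ => normalComp ι ν (chartAt _ x₀) e' w μ) z i μ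
      = κ (e'.symm z) *
        pd (fun w => chartAt (EuclideanSpace ℝ (Fin 4)) x₀ (ι (e'.symm w)) μ) i z := by
  set e := chartAt (EuclideanSpace ℝ (Fin 4)) x₀ with he_def
  have he : e ∈ atlas (EuclideanSpace ℝ (Fin 4)) M := chart_mem_atlas _ x₀
  have hι := hT.embedding.contMDiff
  have hopen := isOpen_chartDomain (e := e) (e' := e') hι.continuous
  have hΦ : DifferentiableAt ℝ (fun w => e (ι (e'.symm w))) z :=
    ((contDiffOn_chartRep hι he he').differentiableOn (by simp)).differentiableAt
      (hopen.mem_nhds hz)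
  have hy : e (ι (e'.symm z)) ∈ e.target := e.map_source hz.2
  -- `b` is the vector ∇_i ν − κ ∂_i. It is orthogonal to ν by the unit condition and normality, and
  -- to tangent vectors by umbilicity, hence zero.
  obtain ⟨b, hb⟩ := exists_chartVec_eq he hz.2 (WithLp.toLp 2 fun μ =>
    covAlong (compMatrix F.g e) (fun w => e (ι (e'.symm w)))
      (fun w μ => normalComp ι ν e e' w μ) z i μ
    - κ (e'.symm z) * pd (fun w => e (ι (e'.symm w)) μ) i z)
  have hperp : ∑ a, ∑ b, compMatrix F.g e (e (ι (e'.symm z))) a b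
      * pd (fun w => e (ι (e'.symm w)) a) i z * normalComp ι ν e e' z b = 0 := by
    have := hT.normal (e'.symm z) (coordVec e' z i)
    rw [(F.lorentzian _).symm, tensor_eq_sum_comp F.g he hz.2] at this
    simp only [chartVec_mfderiv_coordVec hι he he' hz] at this
    exact this
  have hbν : F.g (ι (e'.symm z)) ![b, ν (e'.symm z)] = 0 := by
    have h1 := covAlong_orthogonal_of_unit (G := compMatrix F.g e)
      (N := fun w μ => normalComp ι ν e e' w μ) hΦ
      (fun μ => differentiableAt_chartVec_along hT.smooth_normal hι.continuous x₀ he' hz μ)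
      (fun a b => ((F.smooth_g e he ![a, b]).differentiableOn (by simp)).differentiableAt
        (e.open_target.mem_nhds hy))
      (compMatrix_det_ne_zero F.lorentzian he hz.2)
      (Filter.Eventually.of_forall fun y => compMatrix_symm F.lorentzian y)
      (by
        filter_upwards [hopen.mem_nhds hz] with w hw
        rw [← hT.unit (e'.symm w), tensor_eq_sum_comp F.g he hw.2]
        rfl) i
    rw [tensor_eq_sum_comp F.g he hz.2, hb]
    simp only [mul_sub, sub_mul, Finset.sum_sub_distrib]
    refine sub_eq_zero.2 (h1.trans ?_)
    rw [← mul_zero (κ (e'.symm z)), ← hperp]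
    simp only [Finset.mul_sum]
    refine Finset.sum_congr rfl fun _ _ => Finset.sum_congr rfl fun _ _ => ?_
    simp only [compMatrix, Matrix.of_apply, normalComp, chartVec]
    ring
  have hbX : ∀ j, F.g (ι (e'.symm z))
      ![b, mfderiv (𝓡 3) (𝓡 4) ι (e'.symm z) (coordVec e' z j)] = 0 := by
    intro j
    have h1 := hB.extrinsic e he e' he' z hz.1 hz.2 i j
    have h2 : comp (pullback (m := 3) ι F.g) e' z ![i, j]
        = F.g (ι (e'.symm z)) ![mfderiv (𝓡 3) (𝓡 4) ι (e'.symm z) (coordVec e' z i),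
          mfderiv (𝓡 3) (𝓡 4) ι (e'.symm z) (coordVec e' z j)] := by
      refine congrArg (F.g (ι (e'.symm z))) ?_
      ext k : 1
      fin_cases k <;> rfl
    rw [h2, tensor_eq_sum_comp F.g he hz.2] at h1
    rw [tensor_eq_sum_comp F.g he hz.2, hb]
    simp only [chartVec_mfderiv_coordVec hι he he' hz] at h1 ⊢
    simp only [mul_sub, sub_mul, Finset.sum_sub_distrib]
    refine sub_eq_zero.2 (h1.trans ?_)
    simp only [Finset.mul_sum]
    exact Finset.sum_congr rfl fun _ _ => Finset.sum_congr rfl fun _ _ => by ring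
  have hb0 : b = 0 := by
    refine hT.eq_zero_of_orthogonal _ (fun X => ?_) hbν
    have hd' := mdifferentiable_of_mem he'
    obtain ⟨w, rfl⟩ : ∃ w : EuclideanSpace ℝ (Fin 3),
        mfderiv (𝓡 3) (𝓡 3) e'.symm z w = X := hd'.symm.mfderiv_surjective hz.1 X
    let B : EuclideanSpace ℝ (Fin 3) →ₗ[ℝ] ℝ :=
      (bilinOfMultilinear (F.g (ι (e'.symm z))) b).comp
        ((mfderiv (𝓡 3) (𝓡 4) ι (e'.symm z)).toLinearMap.comp
          (mfderiv (𝓡 3) (𝓡 3) e'.symm z).toLinearMap)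
    change B w = 0
    rw [euclidean_eq_sum_single w, map_sum]
    refine Finset.sum_eq_zero fun j _ => ?_
    rw [map_smul]
    exact (congrArg (w j • ·) (hbX j)).trans (smul_zero _)
  have h0 : chartVec e b = 0 := by
    rw [hb0]
    exact map_zero (mfderiv (𝓡 4) (𝓡 4) e (ι (e'.symm z)))
  rw [hb] at h0
  exact sub_eq_zero.1 (congrArg (fun u : EuclideanSpace ℝ (Fin 4) => u μ) h0)

/-- The points of the hypersurface at which `Ξ = 0` and `dΞ = Σ ν♭`. -/
def conformalZeros (F : ConformalSpacetime M) (ι : N → M)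
    (ν : ∀ p : N, TangentSpace (𝓡 4) (ι p)) (Sg : ℝ) : Set N :=
  {q | F.Xi (ι q) = 0 ∧ ∀ v : TangentSpace (𝓡 4) (ι q),
    differential F.Xi v = Sg * F.g (ι q) ![ν q, v]}

/-- The unknowns `Ξ` and `dΞ - Σ ν♭` of the boundary system, in charts. -/
noncomputable def boundaryUnknowns (F : ConformalSpacetime M) (ι : N → M)
    (ν : ∀ p : N, TangentSpace (𝓡 4) (ι p)) (Sg : ℝ)
    (e : OpenPartialHomeomorph M (EuclideanSpace ℝ (Fin 4)))
    (e' : OpenPartialHomeomorph N (EuclideanSpace ℝ (Fin 3))) (z : EuclideanSpace ℝ (Fin 3)) :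
    Option (Fin 4) → ℝ
  | none => F.Xi (e.symm (e (ι (e'.symm z))))
  | some a => gradDefect (compMatrix F.g e) (fun w => e (ι (e'.symm w)))
      (fun w μ => normalComp ι ν e e' w μ) (fun y => F.Xi (e.symm y)) Sg z a

-- Makes the zero set independent of the charts, so that local unique continuation can be globalised
-- by connectedness.
omit [ChartedSpace (EuclideanSpace ℝ (Fin 3)) N] [IsManifold (𝓡 3) ∞ N] in
lemma boundaryUnknowns_eq_zero_iff {Sg : ℝ}
    {e : OpenPartialHomeomorph M (EuclideanSpace ℝ (Fin 4))}
    (he : e ∈ atlas (EuclideanSpace ℝ (Fin 4)) M)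
    {e' : OpenPartialHomeomorph N (EuclideanSpace ℝ (Fin 3))} {z : EuclideanSpace ℝ (Fin 3)}
    (hz : z ∈ chartDomain ι e e') :
    boundaryUnknowns F ι ν Sg e e' z = 0 ↔ e'.symm z ∈ conformalZeros F ι ν Sg := by
  have hdiff : ∀ v : TangentSpace (𝓡 4) (ι (e'.symm z)),
      differential F.Xi v
      = ∑ a, boundaryUnknowns F ι ν Sg e e' z (some a) * chartVec e v a
        + Sg * F.g (ι (e'.symm z)) ![ν (e'.symm z), v] := by
    intro v
    rw [differential_eq_sum_pd he hz.2 (F.smooth_Xi.mdifferentiable (by simp) _),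
      (F.lorentzian _).symm, tensor_eq_sum_comp F.g he hz.2]
    simp only [boundaryUnknowns, gradDefect, sub_mul, Finset.sum_sub_distrib]
    refine (sub_eq_iff_eq_add.1 (congrArg₂ (· - ·) rfl ?_))
    simp only [Finset.mul_sum, Finset.sum_mul]
    refine Finset.sum_congr rfl fun _ _ => Finset.sum_congr rfl fun _ _ => ?_
    simp only [compMatrix, Matrix.of_apply, normalComp, chartVec]
    ring
  have hnone : boundaryUnknowns F ι ν Sg e e' z none = F.Xi (ι (e'.symm z)) := by
    simp [boundaryUnknowns, e.left_inv hz.2]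
  constructor
  · intro h
    refine ⟨hnone ▸ congrFun h none, fun v => ?_⟩
    rw [hdiff]
    simp [h]
  · rintro ⟨h1, h2⟩
    ext α
    cases α with
    | none => exact hnone.trans h1
    | some a =>
      -- Testing dΞ = Σ ν♭ on the coordinate vector ∂_a isolates the component ω_a.
      obtain ⟨v, hv⟩ := exists_chartVec_eq he hz.2 (EuclideanSpace.single a 1)
      have h3 := left_eq_add.1 ((h2 v).symm.trans ((hdiff v).trans (add_comm _ _)))
      rw [hv] at h3
      simpa using h3

/-- The coefficients of the linear boundary system. -/
noncomputable def boundaryCoeff (F : ConformalSpacetime M) (ι : N → M)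
    (e : OpenPartialHomeomorph M (EuclideanSpace ℝ (Fin 4)))
    (e' : OpenPartialHomeomorph N (EuclideanSpace ℝ (Fin 3))) (i : Fin 3) :
    Option (Fin 4) → Option (Fin 4) → EuclideanSpace ℝ (Fin 3) → ℝ
  | none, none, _ => 0
  | none, some a, z => jacobian ι e e' z i a
  | some a, none, z => ∑ ρ, (-comp F.L e (e (ι (e'.symm z))) ![ρ, a]
      + (1 / 2) * F.Xi (e.symm (e (ι (e'.symm z)))) ^ 2 * comp F.T e (e (ι (e'.symm z))) ![ρ, a])
      * jacobian ι e e' z i ρ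
  | some a, some c, z => ∑ ρ, christoffel (compMatrix F.g e) (e (ι (e'.symm z))) c ρ a
      * jacobian ι e e' z i ρ

lemma contDiffOn_scalar {f : M → ℝ} (hf : ContMDiff (𝓡 4) 𝓘(ℝ, ℝ) ∞ f)
    {e : OpenPartialHomeomorph M (EuclideanSpace ℝ (Fin 4))}
    (he : e ∈ atlas (EuclideanSpace ℝ (Fin 4)) M) :
    ContDiffOn ℝ ∞ (fun y => f (e.symm y)) e.target := by
  rw [← contMDiffOn_iff_contDiffOn]
  exact hf.comp_contMDiffOn (contMDiffOn_symm_of_mem_maximalAtlas (I := 𝓡 4) (n := ∞)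
    (IsManifold.subset_maximalAtlas he))

lemma continuousAt_boundaryCoeff (hι : ContMDiff (𝓡 3) (𝓡 4) ∞ ι)
    {e : OpenPartialHomeomorph M (EuclideanSpace ℝ (Fin 4))}
    (he : e ∈ atlas (EuclideanSpace ℝ (Fin 4)) M)
    {e' : OpenPartialHomeomorph N (EuclideanSpace ℝ (Fin 3))}
    (he' : e' ∈ atlas (EuclideanSpace ℝ (Fin 3)) N) {z : EuclideanSpace ℝ (Fin 3)}
    (hz : z ∈ chartDomain ι e e') (i : Fin 3) (α β : Option (Fin 4)) :
    ContinuousAt (boundaryCoeff F ι e e' i α β) z := by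
  have hopen := isOpen_chartDomain (e := e) (e' := e') hι.continuous
  have hΦ := contDiffOn_chartRep hι he he'
  have hy : e (ι (e'.symm z)) ∈ e.target := e.map_source hz.2
  have hΦc : ContinuousAt (fun w => e (ι (e'.symm w))) z :=
    hΦ.continuousOn.continuousAt (hopen.mem_nhds hz)
  have hJ : ∀ μ, ContinuousAt (fun w => jacobian ι e e' w i μ) z := fun μ =>
    continuousAt_pd ((EuclideanSpace.proj (𝕜 := ℝ) μ).contDiff.comp_contDiffOn hΦ) hopen hz i
  have hcont : ∀ {f : EuclideanSpace ℝ (Fin 4) → ℝ}, ContDiffOn ℝ ∞ f e.target →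
      ContinuousAt (fun w => f (e (ι (e'.symm w)))) z := fun {f} hf =>
    ContinuousAt.comp (f := fun w => e (ι (e'.symm w)))
      (hf.continuousOn.continuousAt (e.open_target.mem_nhds hy)) hΦc
  have hΓ : ∀ c ρ a, ContinuousAt
      (fun w => christoffel (compMatrix F.g e) (e (ι (e'.symm w))) c ρ a) z := fun c ρ a =>
    ContinuousAt.comp (f := fun w => e (ι (e'.symm w)))
      (continuousAt_christoffel (fun a b => F.smooth_g e he ![a, b]) e.open_target hy
        (compMatrix_det_ne_zero F.lorentzian he hz.2) c ρ a) hΦc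
  match α, β with
  | none, none => exact continuousAt_const
  | none, some a => exact hJ a
  | some a, none =>
    refine tendsto_finsetSum _ fun ρ _ => ContinuousAt.mul ?_ (hJ ρ)
    exact (hcont (F.smooth_L e he ![ρ, a])).neg.add
      ((continuousAt_const.mul ((hcont (contDiffOn_scalar F.smooth_Xi he)).pow 2)).mul
        (hcont (F.smooth_T e he ![ρ, a])))
  | some a, some c => exact tendsto_finsetSum _ fun ρ _ => (hΓ c ρ a).mul (hJ ρ)

lemma differentiableAt_boundaryUnknowns (hT : IsTimelikeHypersurface F ι ν) (Sg : ℝ) (x₀ : M)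
    {e' : OpenPartialHomeomorph N (EuclideanSpace ℝ (Fin 3))}
    (he' : e' ∈ atlas (EuclideanSpace ℝ (Fin 3)) N) {z : EuclideanSpace ℝ (Fin 3)}
    (hz : z ∈ chartDomain ι (chartAt (EuclideanSpace ℝ (Fin 4)) x₀) e') (α : Option (Fin 4)) :
    DifferentiableAt ℝ (fun w => boundaryUnknowns F ι ν Sg (chartAt _ x₀) e' w α) z := by
  set e := chartAt (EuclideanSpace ℝ (Fin 4)) x₀ with he_def
  have he : e ∈ atlas (EuclideanSpace ℝ (Fin 4)) M := chart_mem_atlas _ x₀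
  have hι := hT.embedding.contMDiff
  have hopen := isOpen_chartDomain (e := e) (e' := e') hι.continuous
  have hΦ : DifferentiableAt ℝ (fun w => e (ι (e'.symm w))) z :=
    ((contDiffOn_chartRep hι he he').differentiableOn (by simp)).differentiableAt
      (hopen.mem_nhds hz)
  have hy : e (ι (e'.symm z)) ∈ e.target := e.map_source hz.2
  have hξ := contDiffOn_scalar F.smooth_Xi he
  cases α with
  | none =>
    exact DifferentiableAt.comp (f := fun w => e (ι (e'.symm w))) z
      ((hξ.differentiableOn (by simp)).differentiableAt (e.open_target.mem_nhds hy)) hΦ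
  | some a =>
    refine (DifferentiableAt.comp (f := fun w => e (ι (e'.symm w))) z
      (differentiableAt_pd hξ e.open_target hy a) hΦ).sub
      ((differentiableAt_const Sg).mul (DifferentiableAt.fun_sum fun b _ => ?_))
    exact (DifferentiableAt.comp (f := fun w => e (ι (e'.symm w))) z
      (((F.smooth_g e he ![a, b]).differentiableOn (by simp)).differentiableAt
        (e.open_target.mem_nhds hy)) hΦ).mul
      (differentiableAt_chartVec_along hT.smooth_normal hι.continuous x₀ he' hz b)

lemma pd_boundaryUnknowns (hT : IsTimelikeHypersurface F ι ν)
    (hCFE : ∀ p : N, SatisfiesCFEAt F lam (ι p)) (hB : HasBoundaryFields F lam ι ν κ) (x₀ : M)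
    {e' : OpenPartialHomeomorph N (EuclideanSpace ℝ (Fin 3))}
    (he' : e' ∈ atlas (EuclideanSpace ℝ (Fin 3)) N) {z : EuclideanSpace ℝ (Fin 3)}
    (hz : z ∈ chartDomain ι (chartAt (EuclideanSpace ℝ (Fin 4)) x₀) e') (i : Fin 3)
    (α : Option (Fin 4)) :
    pd (fun w => boundaryUnknowns F ι ν (√(|lam| / 3)) (chartAt _ x₀) e' w α) i z
      = ∑ β, boundaryCoeff F ι (chartAt _ x₀) e' i α β z
          * boundaryUnknowns F ι ν (√(|lam| / 3)) (chartAt _ x₀) e' z β := by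
  set e := chartAt (EuclideanSpace ℝ (Fin 4)) x₀ with he_def
  have he : e ∈ atlas (EuclideanSpace ℝ (Fin 4)) M := chart_mem_atlas _ x₀
  have hι := hT.embedding.contMDiff
  have hopen := isOpen_chartDomain (e := e) (e' := e') hι.continuous
  have hΦ : DifferentiableAt ℝ (fun w => e (ι (e'.symm w))) z :=
    ((contDiffOn_chartRep hι he he').differentiableOn (by simp)).differentiableAt
      (hopen.mem_nhds hz)
  have hy : e (ι (e'.symm z)) ∈ e.target := e.map_source hz.2
  have hξ := contDiffOn_scalar F.smooth_Xi he
  rw [Fintype.sum_option]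
  cases α with
  | none =>
    have hperp : ∑ a, ∑ b, compMatrix F.g e (e (ι (e'.symm z))) a b * normalComp ι ν e e' z b
        * pd (fun w => e (ι (e'.symm w)) a) i z = 0 := by
      have := hT.normal (e'.symm z) (coordVec e' z i)
      rw [(F.lorentzian _).symm, tensor_eq_sum_comp F.g he hz.2] at this
      simp only [chartVec_mfderiv_coordVec hι he he' hz] at this
      rw [← this]
      refine Finset.sum_congr rfl fun _ _ => Finset.sum_congr rfl fun _ _ => ?_
      simp only [compMatrix, Matrix.of_apply, normalComp, chartVec]
      ring
    have h := pd_comp_eq_sum_gradDefect (G := compMatrix F.g e)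
      (N := fun w μ => normalComp ι ν e e' w μ) (ξ := fun y => F.Xi (e.symm y))
      (Sg := √(|lam| / 3)) hΦ
      ((hξ.differentiableOn (by simp)).differentiableAt (e.open_target.mem_nhds hy)) hperp
    simp only [boundaryCoeff, zero_mul, zero_add]
    exact h
  | some a =>
    have hcfe := hCFE (e'.symm z) e he hz.2
    refine pd_gradDefect (G := compMatrix F.g e)
      (N := fun w μ => normalComp ι ν e e' w μ) (ξ := fun y => F.Xi (e.symm y))
      (Sg := √(|lam| / 3)) (κ := κ (e'.symm z))
      (l := fun a b => comp F.L e (e (ι (e'.symm z))) ![a, b])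
      (t := fun a b => comp F.T e (e (ι (e'.symm z))) ![a, b]) hΦ
      (fun μ => differentiableAt_chartVec_along hT.smooth_normal hι.continuous x₀ he' hz μ)
      (fun a b => ((F.smooth_g e he ![a, b]).differentiableOn (by simp)).differentiableAt
        (e.open_target.mem_nhds hy))
      (compMatrix_det_ne_zero F.lorentzian he hz.2)
      (Filter.Eventually.of_forall fun y => compMatrix_symm F.lorentzian y)
      (fun a => differentiableAt_pd hξ e.open_target hy a) (fun a b => ?_)
      (fun μ => hB.covAlong_normal hT x₀ he' hz i μ) a
    have h1 := hcfe.hess_Xi a b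
    -- The boundary values of s and Σ put the Hessian equation in the form whose trace part cancels
    -- against the derivative of the normal.
    have h2 : F.s (e.symm (e (ι (e'.symm z)))) = √(|lam| / 3) * κ (e'.symm z) := by
      rw [e.left_inv hz.2, hB.friedrich, hB.sigma]
    rw [h2] at h1
    rw [← covD_covD_scalar]
    exact h1

lemma exists_nhds_conformalZeros (hT : IsTimelikeHypersurface F ι ν)
    (hCFE : ∀ p : N, SatisfiesCFEAt F lam (ι p)) (hB : HasBoundaryFields F lam ι ν κ) (p : N) :
    ∃ W ∈ nhds p, ∀ q ∈ W, ∀ q' ∈ W,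
      q ∈ conformalZeros F ι ν (√(|lam| / 3)) → q' ∈ conformalZeros F ι ν (√(|lam| / 3)) := by
  set e := chartAt (EuclideanSpace ℝ (Fin 4)) (ι p) with he_def
  set e' := chartAt (EuclideanSpace ℝ (Fin 3)) p with he'_def
  have he : e ∈ atlas (EuclideanSpace ℝ (Fin 4)) M := chart_mem_atlas _ _
  have he' : e' ∈ atlas (EuclideanSpace ℝ (Fin 3)) N := chart_mem_atlas _ _
  have hι := hT.embedding.contMDiff
  have hopen := isOpen_chartDomain (e := e) (e' := e') hι.continuous
  have hp : p ∈ e'.source := mem_chart_source _ p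
  have hz : e' p ∈ chartDomain ι e e' := by
    refine ⟨e'.map_source hp, ?_⟩
    rw [Set.mem_preimage, Set.mem_preimage, e'.left_inv hp]
    exact mem_chart_source _ _
  obtain ⟨W, hW, h⟩ := exists_nhds_eq_zero_of_pd_linear
    (boundaryUnknowns F ι ν (√(|lam| / 3)) e e') (boundaryCoeff F ι e e') (e' p)
    (by
      filter_upwards [hopen.mem_nhds hz] with z hz α
      exact differentiableAt_boundaryUnknowns hT _ _ he' hz α)
    (fun i α β => continuousAt_boundaryCoeff hι he he' hz i α β)
    (by
      filter_upwards [hopen.mem_nhds hz] with z hz i α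
      exact pd_boundaryUnknowns hT hCFE hB _ he' hz i α)
  refine ⟨e'.source ∩ e' ⁻¹' (W ∩ chartDomain ι e e'), Filter.inter_mem
    (e'.open_source.mem_nhds hp) ((e'.continuousAt hp).preimage_mem_nhds
      (Filter.inter_mem hW (hopen.mem_nhds hz))), ?_⟩
  rintro q ⟨hq, hqW, hqU⟩ q' ⟨hq', hqW', hqU'⟩ hqZ
  rw [← e'.left_inv hq, ← boundaryUnknowns_eq_zero_iff he hqU] at hqZ
  rw [← e'.left_inv hq', ← boundaryUnknowns_eq_zero_iff he hqU']
  exact h _ hqW _ hqW' hqZ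

variable {S : Type*} [TopologicalSpace S] [ChartedSpace (EuclideanSpace ℝ (Fin 2)) S]
  {j : S → N}

-- Ξ = 0 on the surface alone leaves the derivative transversal to it within the hypersurface
-- undetermined; the constraint for λ makes ∇Ξ − Σν null, and the causal character of the surface
-- then forces it to vanish.
omit [IsManifold (𝓡 3) ∞ N] in
lemma mem_conformalZeros_of_spacelike
    (hlam : lam < 0) (hT : IsTimelikeHypersurface F ι ν)
    (hCFE : ∀ p : N, SatisfiesCFEAt F lam (ι p)) (hB : HasBoundaryFields F lam ι ν κ)
    (hC : IsSpacelikeSurface (pullback (m := 3) ι F.g) j)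
    (hzero : ∀ q : S, F.Xi (ι (j q)) = 0) (q : S) :
    j q ∈ conformalZeros F ι ν (√(|lam| / 3)) := by
  refine ⟨hzero q, ?_⟩
  set x := ι (j q) with hx_def
  set Sg := √(|lam| / 3) with hSg
  have hSg2 : Sg ^ 2 = -lam / 3 := by
    rw [hSg, Real.sq_sqrt (by positivity), abs_of_neg hlam]
  set e := chartAt (EuclideanSpace ℝ (Fin 4)) x with he_def
  have he : e ∈ atlas (EuclideanSpace ℝ (Fin 4)) M := chart_mem_atlas _ _
  have hx : x ∈ e.source := mem_chart_source _ _
  have hXi : MDifferentiableAt (𝓡 4) 𝓘(ℝ, ℝ) F.Xi x := F.smooth_Xi.mdifferentiable (by simp) _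
  let B := bilinOfMultilinear (F.g x)
  have hBs : ∀ u v, B u v = B v u := (F.lorentzian x).symm
  let dXi : TangentSpace (𝓡 4) x →ₗ[ℝ] ℝ := (mfderiv (𝓡 4) 𝓘(ℝ, ℝ) F.Xi x).toLinearMap
  -- `A` is the gradient ∇Ξ as a tangent vector.
  obtain ⟨A, hA⟩ := exists_chartVec_eq he hx (WithLp.toLp 2 (gradXi F e (e x)))
  have hdet := compMatrix_det_ne_zero F.lorentzian he hx
  have hAv : ∀ v, B A v = dXi v := by
    intro v
    refine (tensor_eq_sum_comp F.g he hx A v).trans ?_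
    refine Eq.trans ?_ (differential_eq_sum_pd he hx hXi v).symm
    rw [hA, Finset.sum_comm]
    refine Finset.sum_congr rfl fun b _ => ?_
    rw [← Finset.sum_mul]
    congr 1
    have h1 : (compMatrix F.g e (e x)).mulVec (gradXi F e (e x))
        = fun b => pd (fun z => F.Xi (e.symm z)) b (e x) := by
      change (compMatrix F.g e (e x)).mulVec ((compMatrix F.g e (e x))⁻¹.mulVec
        (fun b => pd (fun z => F.Xi (e.symm z)) b (e x))) = _
      rw [Matrix.mulVec_mulVec, Matrix.mul_nonsing_inv _ (isUnit_iff_ne_zero.2 hdet),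
        Matrix.one_mulVec]
    rw [← congrFun h1 b]
    change _ = ∑ a, compMatrix F.g e (e x) b a * gradXi F e (e x) a
    refine Finset.sum_congr rfl fun a _ => ?_
    rw [compMatrix_symm F.lorentzian]
    rfl
  -- The constraint λ = 6Ξs − 3|∇Ξ|² at Ξ = 0, with λ negative.
  have hAA : B A A = Sg ^ 2 := by
    have h1 := (hCFE (j q) e he hx).lambda_eq
    have h2 : F.Xi (e.symm (e (ι (j q)))) = 0 := by
      rw [e.left_inv hx]
      exact hzero q
    have h3 : dXi A = ∑ c, pd (fun z => F.Xi (e.symm z)) c (e x) * gradXi F e (e x) c := by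
      refine (differential_eq_sum_pd he hx hXi A).trans ?_
      rw [hA]
    rw [h2] at h1
    rw [hAv, h3, hSg2]
    linear_combination (1 / 3) * h1
  have hAν : B A (ν (j q)) = Sg := (hAv _).trans (hB.sigma (j q))
  have hνν : B (ν (j q)) (ν (j q)) = 1 := hT.unit (j q)
  let T : TangentSpace (𝓡 2) q →ₗ[ℝ] TangentSpace (𝓡 4) x :=
    (mfderiv (𝓡 3) (𝓡 4) ι (j q)).toLinearMap.comp (mfderiv (𝓡 2) (𝓡 3) j q).toLinearMap
  have hνT : ∀ X, B (ν (j q)) (T X) = 0 := fun X => hT.normal (j q) _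
  have hTT : ∀ X, X ≠ 0 → 0 < B (T X) (T X) := by
    intro X hX
    refine (hC.spacelike q X hX).trans_eq ?_
    refine congrArg (F.g x) ?_
    ext k : 1
    fin_cases k <;> rfl
  have hAT : ∀ X, B A (T X) = 0 := by
    intro X
    rw [hAv]
    have hι : MDifferentiableAt (𝓡 3) (𝓡 4) ι (j q) :=
      hT.embedding.contMDiff.mdifferentiable (by simp) _
    have hj : MDifferentiableAt (𝓡 2) (𝓡 3) j q :=
      hC.embedding.contMDiff.mdifferentiable (by simp) _
    have h1 : mfderiv (𝓡 2) 𝓘(ℝ, ℝ) (F.Xi ∘ (ι ∘ j)) q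
        = (mfderiv (𝓡 4) 𝓘(ℝ, ℝ) F.Xi x).comp (mfderiv (𝓡 2) (𝓡 4) (ι ∘ j) q) :=
      mfderiv_comp q hXi (hι.comp q hj)
    rw [mfderiv_comp q hι hj] at h1
    have h2 : F.Xi ∘ (ι ∘ j) = fun _ => 0 := funext hzero
    rw [h2, mfderiv_const] at h1
    exact (congrArg (fun f => f X) h1).symm
  have : FiniteDimensional ℝ (TangentSpace (𝓡 4) x) :=
    inferInstanceAs (FiniteDimensional ℝ (EuclideanSpace ℝ (Fin 4)))
  have : FiniteDimensional ℝ (TangentSpace (𝓡 2) q) :=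
    inferInstanceAs (FiniteDimensional ℝ (EuclideanSpace ℝ (Fin 2)))
  have hd2 : Module.finrank ℝ (TangentSpace (𝓡 2) q) = 2 :=
    finrank_euclideanSpace_fin (𝕜 := ℝ) (n := 2)
  have hd4 : Module.finrank ℝ (TangentSpace (𝓡 4) x) = 4 :=
    finrank_euclideanSpace_fin (𝕜 := ℝ) (n := 4)
  -- The hyperplane spanned by the surface directions and ν, of dimension 2 + 1 in 4; it is positive
  -- definite because the two summands are orthogonal and each is spacelike.
  let f : TangentSpace (𝓡 2) q × ℝ →ₗ[ℝ] TangentSpace (𝓡 4) x :=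
    T.coprod (LinearMap.toSpanSingleton ℝ _ (ν (j q)))
  have hf : ∀ X c, f (X, c) = T X + c • ν (j q) := fun X c => rfl
  have hA0 : A - Sg • ν (j q) = 0 := by
    refine eq_zero_of_null_of_orthogonal_hyperplane B
      (fun u hu => (F.lorentzian x).nondegenerate u hu) f
      (by rw [Module.finrank_prod, hd2, hd4, Module.finrank_self]) ?_ ?_ ?_
    · rintro ⟨X, c⟩ hXc
      have h1 : B (f (X, c)) (f (X, c)) = B (T X) (T X) + c ^ 2 := by
        rw [hf]
        simp only [map_add, map_smul, LinearMap.add_apply, LinearMap.smul_apply, smul_eq_mul,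
          hBs (T X) (ν (j q)), hνT, hνν]
        ring
      rw [h1]
      by_cases hX : X = 0
      · have hc : c ≠ 0 := by
          rintro rfl
          exact hXc (by rw [hX]; rfl)
        rw [hX, map_zero, map_zero, zero_add]
        positivity
      · have := hTT X hX
        positivity
    · rintro ⟨X, c⟩
      rw [hf]
      simp only [map_add, map_sub, map_smul, LinearMap.sub_apply, LinearMap.smul_apply,
        smul_eq_mul, hνT, hνν, hAT, hAν]
      ring
    -- Nullity of A − Σν: Σ² − 2Σ·Σ + Σ² = 0.
    · simp only [map_sub, map_smul, LinearMap.sub_apply, LinearMap.smul_apply,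
        smul_eq_mul, hBs (ν (j q)) A, hνν, hAA, hAν]
      ring
  intro v
  refine (hAv v).symm.trans ?_
  rw [sub_eq_zero.1 hA0, map_smul]
  rfl

end Rigidity

end TracefreeCFE

theorem mainTheorem9
    {M : Type*} [TopologicalSpace M] [ChartedSpace (EuclideanSpace ℝ (Fin 4)) M]
    [IsManifold (𝓡 4) ∞ M]
    {N : Type*} [TopologicalSpace N] [ChartedSpace (EuclideanSpace ℝ (Fin 3)) N]
    [IsManifold (𝓡 3) ∞ N] [ConnectedSpace N]
    {S : Type*} [TopologicalSpace S] [ChartedSpace (EuclideanSpace ℝ (Fin 2)) S]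
    [IsManifold (𝓡 2) ∞ S] [Nonempty S]
    (F : TracefreeCFE.ConformalSpacetime M) (lam : ℝ) (hlam : lam < 0)
    (ι : N → M) (ν : ∀ p : N, TangentSpace (𝓡 4) (ι p))
    (hT : TracefreeCFE.IsTimelikeHypersurface F ι ν)
    (hCFE : ∀ p : N, TracefreeCFE.SatisfiesCFEAt F lam (ι p))
    (κ : N → ℝ) (hκ : ContMDiff (𝓡 3) 𝓘(ℝ, ℝ) ∞ κ)
    (hB : TracefreeCFE.HasBoundaryFields F lam ι ν κ)
    (j : S → N)
    (hC : TracefreeCFE.IsSpacelikeSurface (TracefreeCFE.pullback (m := 3) ι F.g) j)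
    (hzero : ∀ q : S, F.Xi (ι (j q)) = 0) :
    ∀ p : N, F.Xi (ι p) = 0 := by
  intro p
  obtain ⟨q⟩ := ‹Nonempty S›
  -- The connectedness argument runs on the smaller set where ω vanishes as well; the zero set of Ξ
  -- alone need not be open.
  exact (TracefreeCFE.mem_of_locally_constant
    (TracefreeCFE.exists_nhds_conformalZeros hT hCFE hB)
    ⟨j q, TracefreeCFE.mem_conformalZeros_of_spacelike hlam hT hCFE hB hC hzero q⟩ p).1
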